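/- Let $\Gamma$ be a finite simple connected graph with $n$ vertices, a chosen base vertex and ordered edges, and let $p_\Gamma(\lambda)$ be its chromatic polynomial. Let $\widetilde C^{i,j}$ be the real vector space spanned by the reduced enhanced states of dimension $i$ and degree $j$: these are the spanning subgraphs with $i$ edges whose connected components are coloured by $1$ and $x$, the component of the base vertex being coloured $x$, with exactly $j+1$ components coloured $x$. The differential $\widetilde C^{i,j}\to\widetilde C^{i+1,j}$ adds an edge in all possible ways, with sign $-1$ if the number of edges of the state preceding the new one is odd and $+1$ otherwise; if the new edge joins two components, their colours are multiplied by $1\cdot1=1$, $1\cdot x=x\cdot 1=x$, $x\cdot x=0$, and otherwise the colouring is kept. Let $\widetilde H^{i,j}(\Gamma)$ be the cohomology of this complex. Then: 1. The graded Euler characteristic is the reduced chromatic polynomial $\widetilde p_\Gamma(\lambda)=p_\Gamma(\lambda)/\lambda$ at $\lambda=1+q$: $$\sum_{i,j}(-1)^i q^j\dim\widetilde H^{i,j}(\Gamma)=\widetilde p_\Gamma(1+q).$$ 2. $\widetilde H^{i,j}(\Gamma)=0$ unless $i+j=n-1$. Hence the $i$-th Betti number $b_i=\sum_j\dim\widetilde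 H^{i,j}(\Gamma)$ equals $\dim\widetilde H^{i,n-1-i}(\Gamma)$ for $0\le i\le n-1$, and the coefficients of the expansion $$p_\Gamma(\lambda)=\sum_{i=0}^{n-1}(-1)^i h_i\,\lambda(\lambda-1)^{n-1-i}$$ are the Betti numbers: this identity holds for integers $h_0,\dots,h_{n-1}$ if and only if $h_i=b_i$ for all $i$. 3. The Poincaré polynomial $\widetilde R_\Gamma(t,q)=\sum_{i,j}t^iq^j\dim\widetilde H^{i,j}(\Gamma)$ satisfies, for all real $q$ and all real $t\neq0$, $$\widetilde R_\Gamma(t,q)=(-t)^{n-1}\,\widetilde p_\Gamma\!\left(\frac{t-q}{t}\right).$$ -/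

import Mathlib

set_option maxSynthPendingDepth 3

open Finset

/-! ## The chromatic polynomial -/

namespace ChromaticCohomology

section Chromatic

variable {V : Type*}

instance [Finite V] : Finite (Setoid V) :=
  Finite.of_injective (fun (σ : Setoid V) (u v : V) => σ u v) fun σ τ h => by
    ext u v
    exact iff_of_eq (congrFun (congrFun h u) v)

/-- A proper colouring by `Fin k` is the same thing as a partition of the vertices into
independent classes together with an injective labelling of the classes. -/
theorem card_coloring_eq [Fintype V] (G : SimpleGraph V) (k : ℕ)
    [Fintype {σ : Setoid V // ∀ u v, G.Adj u v → ¬ σ u v}]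
    [∀ σ : Setoid V, Fintype (Quotient σ)] :
    Nat.card (G.Coloring (Fin k)) =
      ∑ σ : {σ : Setoid V // ∀ u v, G.Adj u v → ¬ σ u v},
        k.descFactorial (Fintype.card (Quotient σ.1)) := by
  classical
  have e : G.Coloring (Fin k) ≃
      Σ σ : {σ : Setoid V // ∀ u v, G.Adj u v → ¬ σ u v}, (Quotient σ.1 ↪ Fin k) :=
    { toFun := fun c => ⟨⟨Setoid.ker c, fun u v h => c.valid h⟩,
        ⟨Setoid.kerLift c, Setoid.kerLift_injective c⟩⟩
      invFun := fun p => SimpleGraph.Coloring.mk (fun v => p.2 (Quotient.mk p.1.1 v))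
        (fun {u v} h hc => p.1.2 u v h (Quotient.exact (p.2.injective hc)))
      left_inv := fun c => by ext v; rfl
      right_inv := by
        rintro ⟨⟨σ, hσ⟩, f⟩
        have h : Setoid.ker (fun v => f (Quotient.mk σ v)) = σ := by
          ext u v
          rw [Setoid.ker_def]
          exact ⟨fun hc => Quotient.exact (f.injective hc), fun hc => by rw [Quotient.sound hc]⟩
        have key : ∀ (τ : Setoid V) (hτ : ∀ u v, G.Adj u v → ¬ τ u v)
            (g : Quotient τ ↪ Fin k), τ = σ →
            (∀ v, g (Quotient.mk τ v) = f (Quotient.mk σ v)) →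
            (⟨⟨τ, hτ⟩, g⟩ : Σ σ : {σ : Setoid V // ∀ u v, G.Adj u v → ¬ σ u v},
              (Quotient σ.1 ↪ Fin k)) = ⟨⟨σ, hσ⟩, f⟩ := by
          intro τ hτ g hEq hg
          subst hEq
          congr 1
          ext q
          induction q using Quotient.inductionOn with
          | h v => rw [hg v]
        exact key _ _ _ h (fun v => rfl) }
  rw [Nat.card_congr e, Nat.card_eq_fintype_card, Fintype.card_sigma]
  refine Finset.sum_congr rfl fun σ _ => ?_
  rw [Fintype.card_embedding_eq, Fintype.card_fin]

theorem exists_chromaticPolynomial [Fintype V] (G : SimpleGraph V) :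
    ∃ p : Polynomial ℤ, ∀ k : ℕ, p.eval (k : ℤ) = Nat.card (G.Coloring (Fin k)) := by
  classical
  have : Fintype {σ : Setoid V // ∀ u v, G.Adj u v → ¬ σ u v} := Fintype.ofFinite _
  refine ⟨∑ σ : {σ : Setoid V // ∀ u v, G.Adj u v → ¬ σ u v},
    descPochhammer ℤ (Fintype.card (Quotient σ.1)), fun k => ?_⟩
  rw [card_coloring_eq, Polynomial.eval_finsetSum]
  push_cast
  exact Finset.sum_congr rfl fun σ _ => descPochhammer_eval_eq_descFactorial ℤ k _

/-- The chromatic polynomial `p_G`: the (unique) polynomial whose value at each natural number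
`k` is the number of proper colourings of `G` with `k` colours. -/
noncomputable def chromaticPolynomial [Fintype V] (G : SimpleGraph V) : Polynomial ℤ :=
  Classical.choose (exists_chromaticPolynomial G)

theorem chromaticPolynomial_eval [Fintype V] (G : SimpleGraph V) (k : ℕ) :
    (chromaticPolynomial G).eval (k : ℤ) = Nat.card (G.Coloring (Fin k)) :=
  Classical.choose_spec (exists_chromaticPolynomial G) k

/-- The reduced chromatic polynomial `p_G(λ) / λ`. The division is exact when the graph has a
vertex, see `X_mul_reducedChromaticPolynomial`. -/
noncomputable def reducedChromaticPolynomial [Fintype V] (G : SimpleGraph V) : Polynomial ℤ :=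
  (chromaticPolynomial G).divX

theorem X_mul_reducedChromaticPolynomial [Fintype V] [Nonempty V] (G : SimpleGraph V) :
    Polynomial.X * reducedChromaticPolynomial G = chromaticPolynomial G := by
  have h0 : (chromaticPolynomial G).coeff 0 = 0 := by
    have h := chromaticPolynomial_eval G 0
    rw [Nat.cast_zero, ← Polynomial.coeff_zero_eq_eval_zero] at h
    have : IsEmpty (G.Coloring (Fin 0)) :=
      ⟨fun c => (c (Classical.arbitrary V)).elim0⟩
    simpa using h
  have h := Polynomial.X_mul_divX_add (chromaticPolynomial G)
  rwa [h0, map_zero, add_zero] at h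

end Chromatic

/-! ## Reduced chromatic cohomology

A finite graph is given by its vertices `V`, its edges `E` (linearly ordered) and the map `ends`
that sends an edge to its pair of endpoints. -/

section Cohomology

variable {V E : Type*}

/-- The simple graph on `V` underlying the state (spanning subgraph) with edge set `s`; it has the
same connected components as the state. -/
def stateGraph (ends : E → Sym2 V) (s : Finset E) : SimpleGraph V :=
  SimpleGraph.fromEdgeSet (ends '' (s : Set E))

theorem stateGraph_mono (ends : E → Sym2 V) {s t : Finset E} (h : s ⊆ t) :
    stateGraph ends s ≤ stateGraph ends t :=
  SimpleGraph.fromEdgeSet_mono (Set.image_mono (Finset.coe_subset.2 h))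

/-- The map on connected components induced by an inclusion of states. -/
def componentMap (ends : E → Sym2 V) {s t : Finset E} (h : s ⊆ t) :
    (stateGraph ends s).ConnectedComponent → (stateGraph ends t).ConnectedComponent :=
  SimpleGraph.ConnectedComponent.map (SimpleGraph.Hom.ofLE (stateGraph_mono ends h))

/-- A reduced enhanced state: a state whose connected components are coloured by `x` and `1`,
the component of the base point `r` being coloured by `x`. The colouring is recorded by the set
of the components of colour `x`. -/
structure ReducedEnhancedState (ends : E → Sym2 V) (r : V) where
  edges : Finset E
  colorX : Set (stateGraph ends edges).ConnectedComponent
  base_mem : (stateGraph ends edges).connectedComponentMk r ∈ colorX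

namespace ReducedEnhancedState

variable {ends : E → Sym2 V} {r : V}

/-- The number of edges of the state. -/
def dimension (S : ReducedEnhancedState ends r) : ℕ := S.edges.card

/-- The number of components coloured by `x`, minus one. -/
noncomputable def degree (S : ReducedEnhancedState ends r) : ℕ := S.colorX.ncard - 1

/-- The state with the edges of `t` added, a new component having colour `x` when one of the old
components it consists of has colour `x`. -/
def enlarge (S : ReducedEnhancedState ends r) (t : Finset E) (h : S.edges ⊆ t) :
    ReducedEnhancedState ends r where
  edges := t
  colorX := componentMap ends h '' S.colorX
  base_mem := ⟨_, S.base_mem, rfl⟩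

end ReducedEnhancedState

open ReducedEnhancedState

/-- All reduced cochains: the real vector space spanned by the reduced enhanced states. -/
abbrev Cochains (ends : E → Sym2 V) (r : V) : Type _ := ReducedEnhancedState ends r →₀ ℝ

/-- The subspace `C^{i,j}` spanned by the reduced enhanced states of dimension `i`, degree `j`. -/
noncomputable def cochainGroup (ends : E → Sym2 V) (r : V) (i j : ℕ) :
    Submodule ℝ (Cochains ends r) :=
  Finsupp.supported ℝ ℝ {S | S.dimension = i ∧ S.degree = j}

open Classical in
/-- The enhanced state `S` with the edges of `t` added, as a cochain, the colours being multiplied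
by the rule `1 * 1 = 1`, `1 * x = x * 1 = x`, `x * x = 0`: the result is `0` when different
components of colour `x` are merged; otherwise a component has colour `x` exactly when it contains
an old component of colour `x`. -/
noncomputable def merge {ends : E → Sym2 V} {r : V} (S : ReducedEnhancedState ends r)
    (t : Finset E) (h : S.edges ⊆ t) : Cochains ends r :=
  if Set.InjOn (componentMap ends h) S.colorX then Finsupp.single (S.enlarge t h) 1 else 0

variable [Fintype E] [LinearOrder E]

/-- The enhanced state `S ∪ e`, as a cochain. -/
noncomputable def addEdge {ends : E → Sym2 V} {r : V} (S : ReducedEnhancedState ends r) (e : E) :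
    Cochains ends r :=
  merge S (insert e S.edges) (Finset.subset_insert e S.edges)

/-- The sign with which the edge `e` is added to the state `s`: it is `-1` if the number of
edges of `s` that precede `e` is odd, and `1` otherwise. -/
def edgeSign (s : Finset E) (e : E) : ℝ := (-1) ^ (s.filter (· < e)).card

/-- The differential: add an edge to a state in all possible ways, with the appropriate sign. -/
noncomputable def differential (ends : E → Sym2 V) (r : V) :
    Cochains ends r →ₗ[ℝ] Cochains ends r :=
  Finsupp.linearCombination ℝ fun S : ReducedEnhancedState ends r =>
    ∑ e ∈ univ \ S.edges, edgeSign S.edges e • addEdge S e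

theorem differential_single {ends : E → Sym2 V} {r : V} (S : ReducedEnhancedState ends r) :
    differential ends r (Finsupp.single S 1) =
      ∑ e ∈ univ \ S.edges, edgeSign S.edges e • addEdge S e := by
  simp [differential]

theorem differential_addEdge {ends : E → Sym2 V} {r : V} (S : ReducedEnhancedState ends r)
    (e : E) :
    differential ends r (addEdge S e) =
      ∑ f ∈ univ \ insert e S.edges, edgeSign (insert e S.edges) f •
        merge S (insert f (insert e S.edges))
          ((Finset.subset_insert _ _).trans (Finset.subset_insert _ _)) := by
  have hcomp : ∀ {s t u : Finset E} (h : s ⊆ t) (h' : t ⊆ u),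
      componentMap ends (h.trans h') = componentMap ends h' ∘ componentMap ends h := by
    intro s t u h h'
    ext c
    induction c using SimpleGraph.ConnectedComponent.ind
    rfl
  by_cases h : Set.InjOn (componentMap ends (Finset.subset_insert e S.edges)) S.colorX
  · have h1 : addEdge S e = Finsupp.single (S.enlarge _ (Finset.subset_insert e S.edges)) 1 :=
      if_pos h
    rw [h1, differential_single]
    refine Finset.sum_congr rfl fun f _ => ?_
    congr 1
    unfold addEdge merge
    have henl : (S.enlarge _ (Finset.subset_insert e S.edges)).enlarge
        (insert f (insert e S.edges)) (Finset.subset_insert _ _) =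
        S.enlarge (insert f (insert e S.edges))
          ((Finset.subset_insert _ _).trans (Finset.subset_insert _ _)) := by
      simp only [enlarge, hcomp (Finset.subset_insert e S.edges)
        (Finset.subset_insert f (insert e S.edges)), Set.image_comp]
    have hinj : Set.InjOn (componentMap ends (Finset.subset_insert f (insert e S.edges)))
          (componentMap ends (Finset.subset_insert e S.edges) '' S.colorX) ↔
        Set.InjOn (componentMap ends ((Finset.subset_insert e S.edges).trans
          (Finset.subset_insert f (insert e S.edges)))) S.colorX := by
      rw [hcomp (Finset.subset_insert e S.edges) (Finset.subset_insert f (insert e S.edges))]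
      refine ⟨fun h' => h'.comp h (Set.mapsTo_image _ _), fun h' => ?_⟩
      exact h'.image_of_comp
    by_cases hc : Set.InjOn (componentMap ends ((Finset.subset_insert e S.edges).trans
        (Finset.subset_insert f (insert e S.edges)))) S.colorX
    · rw [if_pos hc, ← henl]
      exact if_pos (hinj.2 hc)
    · rw [if_neg hc]
      exact if_neg fun h' => hc (hinj.1 h')
  · have h1 : addEdge S e = 0 := if_neg h
    rw [h1, map_zero, eq_comm]
    refine Finset.sum_eq_zero fun f _ => ?_
    have h2 : merge S (insert f (insert e S.edges))
        ((Finset.subset_insert _ _).trans (Finset.subset_insert _ _)) = 0 := by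
      refine if_neg fun h' => h ?_
      rw [hcomp (Finset.subset_insert e S.edges)
        (Finset.subset_insert f (insert e S.edges))] at h'
      exact Set.InjOn.of_comp h'
    rw [h2, smul_zero]

theorem edgeSign_insert {E : Type*} [LinearOrder E] {s : Finset E} {e f : E} (he : e ∉ s) :
    edgeSign (insert e s) f = (if e < f then -1 else 1) * edgeSign s f := by
  unfold edgeSign
  rw [Finset.filter_insert]
  split_ifs with h
  · rw [Finset.card_insert_of_notMem (by simp [he]), pow_succ']
  · simp

/-- The differential squares to zero. -/
theorem differential_comp_self (ends : E → Sym2 V) (r : V) :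
    differential ends r ∘ₗ differential ends r = 0 := by
  refine Finsupp.lhom_ext' fun S => LinearMap.ext_ring ?_
  change differential ends r (differential ends r (Finsupp.single S 1)) = 0
  rw [differential_single, map_sum]
  simp only [map_smul, differential_addEdge, Finset.smul_sum]
  rw [Finset.sum_sigma']
  refine Finset.sum_involution (fun p _ => ⟨p.2, p.1⟩) ?_ ?_ ?_ ?_
  · rintro ⟨e, f⟩ hp
    simp only [Finset.mem_sigma, Finset.mem_sdiff, Finset.mem_univ, true_and,
      Finset.mem_insert, not_or] at hp
    obtain ⟨he, hne, hf⟩ := hp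
    have hm : merge S (insert e (insert f S.edges))
          ((Finset.subset_insert _ _).trans (Finset.subset_insert _ _)) =
        merge S (insert f (insert e S.edges))
          ((Finset.subset_insert _ _).trans (Finset.subset_insert _ _)) := by
      congr 1
      exact Finset.insert_comm e f S.edges
    simp only [hm, smul_smul, ← add_smul, edgeSign_insert he, edgeSign_insert hf]
    rcases lt_or_gt_of_ne hne with h | h
    · rw [if_neg h.not_gt, if_pos h]
      convert zero_smul ℝ _ using 2
      ring
    · rw [if_pos h, if_neg h.not_gt]
      convert zero_smul ℝ _ using 2
      ring
  · rintro ⟨e, f⟩ hp _ h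
    simp only [Finset.mem_sigma, Finset.mem_sdiff, Finset.mem_univ, true_and,
      Finset.mem_insert, not_or] at hp
    exact hp.2.1 (congrArg Sigma.fst h)
  · rintro ⟨e, f⟩ hp
    simp only [Finset.mem_sigma, Finset.mem_sdiff, Finset.mem_univ, true_and,
      Finset.mem_insert, not_or] at hp ⊢
    exact ⟨hp.2.2, fun h => hp.2.1 h.symm, hp.1⟩
  · rintro ⟨e, f⟩ hp
    rfl

/-- The differential raises the dimension by one and preserves the degree. -/
theorem differential_mem_cochainGroup {ends : E → Sym2 V} {r : V} {i j : ℕ}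
    {c : Cochains ends r} (hc : c ∈ cochainGroup ends r i j) :
    differential ends r c ∈ cochainGroup ends r (i + 1) j := by
  rw [differential, Finsupp.linearCombination_apply]
  refine Submodule.sum_mem _ fun S hS => Submodule.smul_mem _ _
    (Submodule.sum_mem _ fun e he => Submodule.smul_mem _ _ ?_)
  have hS' : S.dimension = i ∧ S.degree = j := hc hS
  unfold addEdge merge
  split_ifs with h
  · refine Finsupp.single_mem_supported ℝ _ ⟨?_, ?_⟩
    · rw [← hS'.1]
      exact Finset.card_insert_of_notMem (Finset.mem_sdiff.1 he).2
    · rw [← hS'.2]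
      exact congrArg (· - 1) h.ncard_image
  · exact Submodule.zero_mem _

/-- The differential `d^{i,j} : C^{i,j} → C^{i+1,j}`. -/
noncomputable def differentialAt (ends : E → Sym2 V) (r : V) (i j : ℕ) :
    cochainGroup ends r i j →ₗ[ℝ] cochainGroup ends r (i + 1) j :=
  (differential ends r).restrict fun _ hc => differential_mem_cochainGroup hc

/-- The image of the differential arriving at `C^{i,j}`, where `C^{-1,j} = 0`. -/
noncomputable def coboundaries (ends : E → Sym2 V) (r : V) :
    (i j : ℕ) → Submodule ℝ (cochainGroup ends r i j)
  | 0, _ => ⊥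
  | i + 1, j => LinearMap.range (differentialAt ends r i j)

theorem coboundaries_le_ker (ends : E → Sym2 V) (r : V) (i j : ℕ) :
    coboundaries ends r i j ≤ LinearMap.ker (differentialAt ends r i j) := by
  cases i with
  | zero => exact bot_le
  | succ i =>
    rintro _ ⟨c, rfl⟩
    rw [LinearMap.mem_ker]
    exact Subtype.ext (LinearMap.congr_fun (differential_comp_self ends r) c)

/-- The reduced chromatic cohomology `H^{i,j}`: cocycles modulo coboundaries. -/
abbrev ReducedCohomology (ends : E → Sym2 V) (r : V) (i j : ℕ) : Type _ :=
  LinearMap.ker (differentialAt ends r i j) ⧸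
    (coboundaries ends r i j).submoduleOf (LinearMap.ker (differentialAt ends r i j))

end Cohomology

/-! ## Invariants of a simple graph -/

section SimpleGraph

variable {V : Type*} (G : SimpleGraph V) [Fintype G.edgeSet] [LinearOrder G.edgeSet] (r : V)

/-- The reduced chromatic cohomology of the simple graph `G` with base point `r`. -/
abbrev reducedCohomology (i j : ℕ) : Type _ :=
  ReducedCohomology (fun e : G.edgeSet => (e : Sym2 V)) r i j

/-- `dim H^{i,j}(G)`. -/
noncomputable def reducedCohomologyDim (i j : ℕ) : ℕ :=
  Module.finrank ℝ (reducedCohomology G r i j)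

variable [Fintype V]

/-- The graded Euler characteristic `∑ (-1)^i q^j dim H^{i,j}(G)`, a polynomial in `q`. The
dimension of a state is at most the number of edges, and its degree is less than the number of
vertices, so that all other cochain groups vanish. -/
noncomputable def gradedEulerCharacteristic : Polynomial ℤ :=
  ∑ i ∈ range (Fintype.card G.edgeSet + 1), ∑ j ∈ range (Fintype.card V),
    (-1) ^ i * Polynomial.X ^ j * (reducedCohomologyDim G r i j : Polynomial ℤ)

/-- The `i`-th Betti number: the dimension of `H^i(G)`, the direct sum of all `H^{i,j}(G)`. -/
noncomputable def bettiNumber (i : ℕ) : ℕ :=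
  ∑ j ∈ range (Fintype.card V), reducedCohomologyDim G r i j

/-- The Poincaré polynomial `∑ t^i q^j dim H^{i,j}(G)`, where `t` is the variable `X 0` and `q` is
the variable `X 1`. -/
noncomputable def reducedPoincarePolynomial : MvPolynomial (Fin 2) ℤ :=
  ∑ i ∈ range (Fintype.card G.edgeSet + 1), ∑ j ∈ range (Fintype.card V),
    MvPolynomial.X 0 ^ i * MvPolynomial.X 1 ^ j *
      (reducedCohomologyDim G r i j : MvPolynomial (Fin 2) ℤ)

end SimpleGraph

end ChromaticCohomology

/-! The heart is the vanishing off the diagonal, proved by deletion and contraction. For disjoint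
edge sets `F` and `D`, the states between `F` and `F ∪ D` span the complex of the multigraph in
which `F` is contracted and only `D` is kept, shifted by the size of `F`. The claim is exactness
away from one diagonal whenever `F ∪ D` connects all vertices (`exists_partialDifferential_eq`); the
theorem is the case `F = ∅`.

Choose an edge `e` with an endpoint `p` in the base component and another endpoint `q`. The complex
is then the mapping cone of the map `d_e` that adds `e`, from the deletion of `e` to the contraction
of `e`. Since the base component is coloured `x` and `1 * x = x`, `d_e` is onto
(`exists_edgeOp_eq`), so only its kernel matters. If `e` is a loop after contracting `F`, `d_e` is
injective and the complex is acyclic. If `e` is neither a loop nor a bridge, deletion and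
contraction are both connected and have the same diagonal, and the induction hypothesis applies to
both. If `e` is a bridge, the kernel is spanned by the states in which `q` is coloured `x`, and
joining the two `x`-components identifies it with the contraction complex, at the cost of a shift
that preserves dimension plus degree minus the number of contracted edges minus the number of
components of the contracted graph. When no edge is left at the base component, connectedness leaves
a single state, on the diagonal.

The Euler characteristic is computed on cochains: each spanning subgraph `s` with `k(s)` components
contributes `(-1)^|s| (1+q)^(k(s)-1)`, which is Whitney's expansion (`chromaticPolynomial_eq_sum`)
divided by `λ` at `λ = 1 + q`. Concentration on the diagonal then allows each Betti number to be
read off as a coefficient, up to sign, and gives the Poincaré polynomial by substitution. -/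

namespace ChromaticCohomology

/-! ### Components and colours when one edge is added or removed -/

section States

variable {V E : Type*} {ends : E → Sym2 V} {r : V}

theorem reachable_stateGraph_mono {s t : Finset E} (h : s ⊆ t) {v w : V}
    (hvw : (stateGraph ends s).Reachable v w) : (stateGraph ends t).Reachable v w :=
  hvw.mono (stateGraph_mono ends h)

theorem reachable_of_mem {s : Finset E} {e : E} {p q : V} (he : ends e = s(p, q)) (hs : e ∈ s) :
    (stateGraph ends s).Reachable p q := by
  by_cases h : p = q
  · rw [h]
  · refine SimpleGraph.Adj.reachable ?_
    rw [stateGraph, SimpleGraph.fromEdgeSet_adj]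
    exact ⟨⟨e, hs, he⟩, h⟩

/-- Adding an edge joins the components of its endpoints, and no others. -/
theorem reachable_insert [DecidableEq E] {s : Finset E} {e : E} {p q : V} (he : ends e = s(p, q))
    {v w : V} :
    (stateGraph ends (insert e s)).Reachable v w ↔ (stateGraph ends s).Reachable v w ∨
      ((stateGraph ends s).Reachable v p ∧ (stateGraph ends s).Reachable q w) ∨
      ((stateGraph ends s).Reachable v q ∧ (stateGraph ends s).Reachable p w) := by
  constructor
  · rintro ⟨W⟩
    induction W with
    | nil => exact Or.inl (SimpleGraph.Reachable.refl _)
    | @cons a b c hab _ ih =>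
      rw [stateGraph, SimpleGraph.fromEdgeSet_adj] at hab
      obtain ⟨⟨f, hf, hfe⟩, hne⟩ := hab
      rw [Finset.mem_coe, Finset.mem_insert] at hf
      have tr : ∀ {x y z : V}, (stateGraph ends s).Reachable x y →
        (stateGraph ends s).Reachable y z → (stateGraph ends s).Reachable x z :=
        fun h h' => h.trans h'
      have sy : ∀ {x y : V}, (stateGraph ends s).Reachable x y →
        (stateGraph ends s).Reachable y x := fun h => h.symm
      have rf : ∀ x : V, (stateGraph ends s).Reachable x x := fun x => SimpleGraph.Reachable.refl x
      rcases hf with rfl | hf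
      · rw [he, Sym2.eq_iff] at hfe
        rcases hfe with ⟨rfl, rfl⟩ | ⟨rfl, rfl⟩
        · rcases ih with h | ⟨h, h'⟩ | ⟨h, h'⟩
          · exact Or.inr (Or.inl ⟨rf _, h⟩)
          · exact Or.inr (Or.inl ⟨rf _, h'⟩)
          · exact Or.inl h'
        · rcases ih with h | ⟨h, h'⟩ | ⟨h, h'⟩
          · exact Or.inr (Or.inr ⟨rf _, h⟩)
          · exact Or.inl h'
          · exact Or.inr (Or.inr ⟨rf _, h'⟩)
      · have hab : (stateGraph ends s).Reachable a b := reachable_of_mem hfe hf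
        rcases ih with h | ⟨h, h'⟩ | ⟨h, h'⟩
        · exact Or.inl (tr hab h)
        · exact Or.inr (Or.inl ⟨tr hab h, h'⟩)
        · exact Or.inr (Or.inr ⟨tr hab h, h'⟩)
  · have hpq := reachable_of_mem (s := insert e s) he (Finset.mem_insert_self e s)
    have hm : ∀ {x y : V}, (stateGraph ends s).Reachable x y →
        (stateGraph ends (insert e s)).Reachable x y :=
      fun h => reachable_stateGraph_mono (Finset.subset_insert e s) h
    rintro (h | ⟨h, h'⟩ | ⟨h, h'⟩)
    · exact hm h
    · exact (hm h).trans (hpq.trans (hm h'))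
    · exact (hm h).trans (hpq.symm.trans (hm h'))

theorem componentMap_surjective {s t : Finset E} (h : s ⊆ t) :
    Function.Surjective (componentMap ends h) := by
  intro c
  induction c using SimpleGraph.ConnectedComponent.ind with
  | h v => exact ⟨(stateGraph ends s).connectedComponentMk v, rfl⟩

theorem componentMap_comp {s t u : Finset E} (h : s ⊆ t) (h' : t ⊆ u) :
    componentMap ends (h.trans h') = componentMap ends h' ∘ componentMap ends h := by
  ext c
  induction c using SimpleGraph.ConnectedComponent.ind
  rfl

theorem componentMap_mk_eq_iff {s t : Finset E} (h : s ⊆ t) {v w : V} :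
    componentMap ends h ((stateGraph ends s).connectedComponentMk v) =
      componentMap ends h ((stateGraph ends s).connectedComponentMk w) ↔
      (stateGraph ends t).Reachable v w :=
  SimpleGraph.ConnectedComponent.eq

/-- An edge that joins two components of a set lowers the number of components in it by one. -/
theorem ncard_image_componentMap [DecidableEq E] [Finite V] {s : Finset E} {e : E} {p q : V}
    (he : ends e = s(p, q)) (hpq : ¬ (stateGraph ends s).Reachable p q)
    {X : Set (stateGraph ends s).ConnectedComponent}
    (hp : (stateGraph ends s).connectedComponentMk p ∈ X)
    (hq : (stateGraph ends s).connectedComponentMk q ∈ X) :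
    (componentMap ends (Finset.subset_insert e s) '' X).ncard + 1 = X.ncard := by
  have hX : componentMap ends (Finset.subset_insert e s) '' X =
      componentMap ends (Finset.subset_insert e s) ''
        (X \ {(stateGraph ends s).connectedComponentMk q}) := by
    refine Set.Subset.antisymm ?_ (Set.image_mono Set.sdiff_subset)
    rintro _ ⟨c, hc, rfl⟩
    by_cases hcq : c = (stateGraph ends s).connectedComponentMk q
    · refine ⟨(stateGraph ends s).connectedComponentMk p, ⟨hp, ?_⟩, ?_⟩
      · exact fun h => hpq (SimpleGraph.ConnectedComponent.exact h)
      · rw [hcq, componentMap_mk_eq_iff]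
        exact reachable_of_mem he (Finset.mem_insert_self e s)
    · exact ⟨c, ⟨hc, hcq⟩, rfl⟩
  have hinj : Set.InjOn (componentMap ends (Finset.subset_insert e s))
      (X \ {(stateGraph ends s).connectedComponentMk q}) := by
    rintro c ⟨-, hc⟩ d ⟨-, hd⟩ hcd
    induction c using SimpleGraph.ConnectedComponent.ind with
    | h v =>
      induction d using SimpleGraph.ConnectedComponent.ind with
      | h w =>
        rw [componentMap_mk_eq_iff, reachable_insert he] at hcd
        rcases hcd with h | ⟨-, h⟩ | ⟨h, -⟩
        · exact SimpleGraph.ConnectedComponent.sound h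
        · exact absurd (SimpleGraph.ConnectedComponent.sound h.symm) hd
        · exact absurd (SimpleGraph.ConnectedComponent.sound h) hc
  rw [hX, hinj.ncard_image]
  exact Set.ncard_sdiff_singleton_add_one hq (Set.toFinite _)

/-- The number of components of a state. -/
noncomputable def numComponents (ends : E → Sym2 V) (s : Finset E) : ℕ :=
  Nat.card (stateGraph ends s).ConnectedComponent

theorem numComponents_insert [DecidableEq E] [Finite V] {s : Finset E} {e : E} {p q : V}
    (he : ends e = s(p, q)) (hpq : ¬ (stateGraph ends s).Reachable p q) :
    numComponents ends (insert e s) + 1 = numComponents ends s := by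
  have h := ncard_image_componentMap he hpq (Set.mem_univ _) (Set.mem_univ _)
  rwa [Set.image_univ, (componentMap_surjective _).range_eq, Set.ncard_univ, Set.ncard_univ] at h

namespace ReducedEnhancedState

/-- The component of the vertex `v` has colour `x`. -/
def IsX (S : ReducedEnhancedState ends r) (v : V) : Prop :=
  (stateGraph ends S.edges).connectedComponentMk v ∈ S.colorX

theorem IsX.congr {S : ReducedEnhancedState ends r} {v w : V}
    (h : (stateGraph ends S.edges).Reachable v w) (hv : S.IsX v) : S.IsX w := by
  unfold IsX at *
  rwa [← SimpleGraph.ConnectedComponent.sound h]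

theorem isX_base (S : ReducedEnhancedState ends r) : S.IsX r := S.base_mem

/-- The type of components depends on the edge set, so colourings of different states are compared
through the vertices. -/
theorem ext_isX {S T : ReducedEnhancedState ends r} (h : S.edges = T.edges)
    (hX : ∀ v, S.IsX v ↔ T.IsX v) : S = T := by
  obtain ⟨s, X, hr⟩ := S
  obtain ⟨t, Y, hr'⟩ := T
  obtain rfl : s = t := h
  congr
  ext c
  induction c using SimpleGraph.ConnectedComponent.ind with
  | h v => exact hX v

/-- The state with edge set `s` whose vertices of colour `x` are those in `U`. -/
def ofPred (s : Finset E) (U : V → Prop)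
    (_hU : ∀ v w, (stateGraph ends s).Reachable v w → U v → U w) (hr : U r) :
    ReducedEnhancedState ends r where
  edges := s
  colorX := {c | ∃ v, (stateGraph ends s).connectedComponentMk v = c ∧ U v}
  base_mem := ⟨r, rfl, hr⟩

theorem isX_ofPred {s : Finset E} {U : V → Prop}
    (hU : ∀ v w, (stateGraph ends s).Reachable v w → U v → U w) (hr : U r) {v : V} :
    (ofPred s U hU hr).IsX v ↔ U v := by
  constructor
  · rintro ⟨w, h, hw⟩
    exact hU w v (SimpleGraph.ConnectedComponent.exact h) hw
  · exact fun h => ⟨v, rfl, h⟩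

theorem isX_enlarge {S : ReducedEnhancedState ends r} {t : Finset E} {h : S.edges ⊆ t} {v : V} :
    (S.enlarge t h).IsX v ↔ ∃ w, S.IsX w ∧ (stateGraph ends t).Reachable w v := by
  constructor
  · rintro ⟨c, hc, hcv⟩
    induction c using SimpleGraph.ConnectedComponent.ind with
    | h w => exact ⟨w, hc, SimpleGraph.ConnectedComponent.exact hcv⟩
  · rintro ⟨w, hw, hwv⟩
    exact ⟨_, hw, SimpleGraph.ConnectedComponent.sound hwv⟩

theorem enlarge_enlarge (S : ReducedEnhancedState ends r) {t u : Finset E} (h : S.edges ⊆ t)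
    (h' : t ⊆ u) : (S.enlarge t h).enlarge u h' = S.enlarge u (h.trans h') := by
  simp only [enlarge, componentMap_comp h h', Set.image_comp]

variable [DecidableEq E]

/-- The state with the edge `e` added, a new component having colour `x` when one of the old
components it consists of has colour `x`. -/
def adjoin (e : E) (S : ReducedEnhancedState ends r) : ReducedEnhancedState ends r :=
  S.enlarge (insert e S.edges) (Finset.subset_insert e S.edges)

theorem edges_adjoin (e : E) (S : ReducedEnhancedState ends r) :
    (S.adjoin e).edges = insert e S.edges := rfl

theorem isX_adjoin {S : ReducedEnhancedState ends r} {e : E} {p q : V} (he : ends e = s(p, q))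
    {v : V} : (S.adjoin e).IsX v ↔ S.IsX v ∨
      (S.IsX p ∧ (stateGraph ends S.edges).Reachable q v) ∨
      (S.IsX q ∧ (stateGraph ends S.edges).Reachable p v) := by
  rw [adjoin, isX_enlarge]
  constructor
  · rintro ⟨w, hw, h⟩
    rw [reachable_insert he] at h
    rcases h with h | ⟨h, h'⟩ | ⟨h, h'⟩
    · exact Or.inl (hw.congr h)
    · exact Or.inr (Or.inl ⟨hw.congr h, h'⟩)
    · exact Or.inr (Or.inr ⟨hw.congr h, h'⟩)
  · have hpq := reachable_of_mem (s := insert e S.edges) he (Finset.mem_insert_self e _)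
    have hm : ∀ {x y : V}, (stateGraph ends S.edges).Reachable x y →
        (stateGraph ends (insert e S.edges)).Reachable x y :=
      fun h => reachable_stateGraph_mono (Finset.subset_insert e _) h
    rintro (h | ⟨h, h'⟩ | ⟨h, h'⟩)
    · exact ⟨v, h, SimpleGraph.Reachable.refl _⟩
    · exact ⟨p, h, hpq.trans (hm h')⟩
    · exact ⟨q, h, hpq.symm.trans (hm h')⟩

/-- The edge `e` does not merge different components of colour `x` exactly if this holds for the
components of its endpoints. -/
theorem injOn_insert_iff {S : ReducedEnhancedState ends r} {e : E} {p q : V}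
    (he : ends e = s(p, q)) :
    Set.InjOn (componentMap ends (Finset.subset_insert e S.edges)) S.colorX ↔
      (S.IsX p → S.IsX q → (stateGraph ends S.edges).Reachable p q) := by
  constructor
  · intro h hp hq
    refine SimpleGraph.ConnectedComponent.exact (h hp hq ?_)
    rw [componentMap_mk_eq_iff]
    exact reachable_of_mem he (Finset.mem_insert_self e _)
  · intro h c hc d hd hcd
    induction c using SimpleGraph.ConnectedComponent.ind with
    | h v =>
      induction d using SimpleGraph.ConnectedComponent.ind with
      | h w =>
        refine SimpleGraph.ConnectedComponent.sound ?_
        rw [componentMap_mk_eq_iff, reachable_insert he] at hcd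
        rcases hcd with h1 | ⟨h1, h2⟩ | ⟨h1, h2⟩
        · exact h1
        · exact h1.trans ((h (IsX.congr h1 hc) (IsX.congr h2.symm hd)).trans h2)
        · exact h1.trans ((h (IsX.congr h2.symm hd) (IsX.congr h1 hc)).symm.trans h2)

/-- The state with the edge `e` removed, all vertices keeping their colours. -/
def detach (e : E) (T : ReducedEnhancedState ends r) : ReducedEnhancedState ends r :=
  ofPred (T.edges.erase e) T.IsX
    (fun _ _ h hv => hv.congr (reachable_stateGraph_mono (Finset.erase_subset e _) h)) T.isX_base

theorem edges_detach (e : E) (T : ReducedEnhancedState ends r) :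
    (T.detach e).edges = T.edges.erase e := rfl

theorem isX_detach {e : E} {T : ReducedEnhancedState ends r} {v : V} :
    (T.detach e).IsX v ↔ T.IsX v := isX_ofPred _ _

/-- The state with the edge `e` removed, all vertices keeping their colours except that the
component of `q` gets the colour `1` unless it contains the base point. -/
def split (e : E) (q : V) (T : ReducedEnhancedState ends r) : ReducedEnhancedState ends r :=
  ofPred (T.edges.erase e)
    (fun v => T.IsX v ∧ ((stateGraph ends (T.edges.erase e)).Reachable v r ∨
      ¬ (stateGraph ends (T.edges.erase e)).Reachable v q))
    (fun _ _ h hv => ⟨hv.1.congr (reachable_stateGraph_mono (Finset.erase_subset e _) h),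
      hv.2.imp h.symm.trans fun hn hw => hn (h.trans hw)⟩)
    ⟨T.isX_base, Or.inl (SimpleGraph.Reachable.refl _)⟩

theorem edges_split (e : E) (q : V) (T : ReducedEnhancedState ends r) :
    (T.split e q).edges = T.edges.erase e := rfl

theorem isX_split {e : E} {q : V} {T : ReducedEnhancedState ends r} {v : V} :
    (T.split e q).IsX v ↔ T.IsX v ∧ ((stateGraph ends (T.edges.erase e)).Reachable v r ∨
      ¬ (stateGraph ends (T.edges.erase e)).Reachable v q) := isX_ofPred _ _

theorem adjoin_detach {e : E} {p q : V} (he : ends e = s(p, q)) {T : ReducedEnhancedState ends r}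
    (hT : e ∈ T.edges) : (T.detach e).adjoin e = T := by
  refine ext_isX (by rw [edges_adjoin, edges_detach, Finset.insert_erase hT]) fun v => ?_
  have hpq := reachable_of_mem (s := T.edges) he hT
  rw [isX_adjoin he, isX_detach, isX_detach, isX_detach, edges_detach]
  refine ⟨?_, Or.inl⟩
  rintro (h | ⟨h, h'⟩ | ⟨h, h'⟩)
  · exact h
  · exact h.congr (hpq.trans (reachable_stateGraph_mono (Finset.erase_subset e _) h'))
  · exact h.congr (hpq.symm.trans (reachable_stateGraph_mono (Finset.erase_subset e _) h'))

/-- Colours survive only because both endpoints already have colour `x`: no vertex is recoloured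
when `e` is added. -/
theorem detach_adjoin {e : E} {p q : V} (he : ends e = s(p, q)) {S : ReducedEnhancedState ends r}
    (hS : e ∉ S.edges) (hp : S.IsX p) (hq : S.IsX q) : (S.adjoin e).detach e = S := by
  refine ext_isX (by rw [edges_detach, edges_adjoin, Finset.erase_insert hS]) fun v => ?_
  rw [isX_detach, isX_adjoin he]
  exact ⟨fun h => h.elim id fun h => h.elim (fun h => hq.congr h.2) fun h => hp.congr h.2, Or.inl⟩

/-- The piece cut off at `q` was coloured `x` in `T` because it hung on the base component; it
becomes `1` in `split`, and adding `e` back restores `x` by `1 * x = x`. -/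
theorem adjoin_split {e : E} {p q : V} (he : ends e = s(p, q)) {T : ReducedEnhancedState ends r}
    (hT : e ∈ T.edges) (hp : (stateGraph ends (T.edges.erase e)).Reachable p r) :
    (T.split e q).adjoin e = T := by
  refine ext_isX (by rw [edges_adjoin, edges_split, Finset.insert_erase hT]) fun v => ?_
  have hpq := reachable_of_mem (s := T.edges) he hT
  have hm : ∀ {x y : V}, (stateGraph ends (T.edges.erase e)).Reachable x y →
      (stateGraph ends T.edges).Reachable x y :=
    fun h => reachable_stateGraph_mono (Finset.erase_subset e _) h
  rw [isX_adjoin he, isX_split, isX_split, isX_split, edges_split]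
  constructor
  · rintro (h | ⟨h, h'⟩ | ⟨h, h'⟩)
    · exact h.1
    · exact h.1.congr (hpq.trans (hm h'))
    · exact h.1.congr (hpq.symm.trans (hm h'))
  · intro h
    by_cases hv : (stateGraph ends (T.edges.erase e)).Reachable v q
    · exact Or.inr (Or.inl ⟨⟨T.isX_base.congr (hm hp.symm), Or.inl hp⟩, hv.symm⟩)
    · exact Or.inl ⟨h, Or.inr hv⟩

theorem split_adjoin {e : E} {p q : V} (he : ends e = s(p, q)) {S : ReducedEnhancedState ends r}
    (hS : e ∉ S.edges) (hp : (stateGraph ends S.edges).Reachable p r)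
    (hq : S.IsX q → (stateGraph ends S.edges).Reachable p q) : (S.adjoin e).split e q = S := by
  refine ext_isX (by rw [edges_split, edges_adjoin, Finset.erase_insert hS]) fun v => ?_
  rw [isX_split, isX_adjoin he, edges_adjoin, Finset.erase_insert hS]
  have hpX : S.IsX p := S.isX_base.congr hp.symm
  constructor
  · rintro ⟨h | ⟨-, h⟩ | ⟨-, h⟩, h'⟩
    · exact h
    · exact h'.elim (fun h' => S.isX_base.congr h'.symm) fun h' => absurd h.symm h'
    · exact hpX.congr h
  · intro h
    refine ⟨Or.inl h, ?_⟩
    by_cases hv : (stateGraph ends S.edges).Reachable v q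
    · exact Or.inl (hv.trans ((hq (h.congr hv)).symm.trans hp))
    · exact Or.inr hv

/-- This ensures that adding `e` back after `split` is never the vanishing case `x * x = 0`. -/
theorem split_injective_condition {e : E} {p q : V} {T : ReducedEnhancedState ends r}
    (hp : (stateGraph ends (T.edges.erase e)).Reachable p r) (hq : (T.split e q).IsX q) :
    (stateGraph ends (T.split e q).edges).Reachable p q := by
  rw [isX_split] at hq
  rcases hq.2 with h | h
  · exact hp.trans h.symm
  · exact absurd (SimpleGraph.Reachable.refl q) h

theorem adjoin_comm (S : ReducedEnhancedState ends r) (e f : E) :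
    (S.adjoin e).adjoin f = (S.adjoin f).adjoin e := by
  have h : ∀ {t u : Finset E} (ht : S.edges ⊆ t) (hu : S.edges ⊆ u), t = u →
      S.enlarge t ht = S.enlarge u hu := by
    rintro t u ht hu rfl
    rfl
  exact (enlarge_enlarge S _ _).trans
    ((h _ _ (Finset.insert_comm f e S.edges)).trans (enlarge_enlarge S _ _).symm)

theorem dimension_adjoin {S : ReducedEnhancedState ends r} {e : E} (h : e ∉ S.edges) :
    (S.adjoin e).dimension = S.dimension + 1 := Finset.card_insert_of_notMem h

theorem degree_adjoin {S : ReducedEnhancedState ends r} {e : E} {p q : V} (he : ends e = s(p, q))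
    (h : S.IsX p → S.IsX q → (stateGraph ends S.edges).Reachable p q) :
    (S.adjoin e).degree = S.degree :=
  congrArg (· - 1) ((injOn_insert_iff he).2 h).ncard_image

theorem degree_adjoin_add_one [Finite V] {S : ReducedEnhancedState ends r} {e : E} {p q : V}
    (he : ends e = s(p, q)) (hp : S.IsX p) (hq : S.IsX q)
    (h : ¬ (stateGraph ends S.edges).Reachable p q) :
    (S.adjoin e).degree + 1 = S.degree := by
  have h1 := ncard_image_componentMap he h hp hq
  have h2 : 0 < (S.adjoin e).colorX.ncard :=
    (Set.ncard_pos (Set.toFinite _)).2 ⟨_, (S.adjoin e).base_mem⟩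
  have h3 : (S.adjoin e).colorX.ncard + 1 = S.colorX.ncard := h1
  unfold degree
  omega

end ReducedEnhancedState

end States

open ReducedEnhancedState

/-! ### The differential as a sum of anticommuting operators, one for each edge -/

section Operators

variable {V E : Type*} [LinearOrder E] {ends : E → Sym2 V} {r : V}

theorem edgeSign_mul_self (s : Finset E) (e : E) : edgeSign s e * edgeSign s e = 1 := by
  unfold edgeSign
  rw [← mul_pow]
  norm_num

theorem edgeSign_insert_self (s : Finset E) (e : E) : edgeSign (insert e s) e = edgeSign s e := by
  unfold edgeSign
  rw [Finset.filter_insert, if_neg (lt_irrefl e)]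

theorem edgeSign_erase_self (s : Finset E) (e : E) : edgeSign (s.erase e) e = edgeSign s e := by
  by_cases h : e ∈ s
  · rw [← edgeSign_insert_self, Finset.insert_erase h]
  · rw [Finset.erase_eq_of_notMem h]

/-- Of two different edges exactly one precedes the other, so exactly one of the two signs is
flipped by the presence of the other edge. -/
theorem edgeSign_mul_comm {s : Finset E} {e f : E} (he : e ∉ s) (hf : f ∉ s) (hef : e ≠ f) :
    edgeSign s e * edgeSign (insert e s) f = -(edgeSign s f * edgeSign (insert f s) e) := by
  rw [edgeSign_insert he, edgeSign_insert hf]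
  rcases lt_or_gt_of_ne hef with h | h
  · rw [if_pos h, if_neg h.not_gt]
    ring
  · rw [if_neg h.not_gt, if_pos h]
    ring

/-- The part of the differential that adds the edge `e`. -/
noncomputable def edgeOp (ends : E → Sym2 V) (r : V) (e : E) :
    Cochains ends r →ₗ[ℝ] Cochains ends r :=
  Finsupp.linearCombination ℝ fun S : ReducedEnhancedState ends r =>
    if e ∈ S.edges then 0 else edgeSign S.edges e • addEdge S e

/-- The linear map that applies `g` to the states, with the sign of the edge `e`. -/
noncomputable def signedMap (e : E) (g : ReducedEnhancedState ends r → ReducedEnhancedState ends r) :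
    Cochains ends r →ₗ[ℝ] Cochains ends r :=
  Finsupp.linearCombination ℝ fun S : ReducedEnhancedState ends r =>
    edgeSign S.edges e • Finsupp.single (g S) 1

theorem signedMap_single (e : E)
    (g : ReducedEnhancedState ends r → ReducedEnhancedState ends r)
    (S : ReducedEnhancedState ends r) :
    signedMap e g (Finsupp.single S 1) = edgeSign S.edges e • Finsupp.single (g S) 1 := by
  simp [signedMap]

theorem edgeOp_single_of_mem {e : E} {S : ReducedEnhancedState ends r} (h : e ∈ S.edges) :
    edgeOp ends r e (Finsupp.single S 1) = 0 := by
  simp [edgeOp, h]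

theorem edgeOp_single_of_notMem {e : E} {S : ReducedEnhancedState ends r} (h : e ∉ S.edges) :
    edgeOp ends r e (Finsupp.single S 1) = edgeSign S.edges e • addEdge S e := by
  simp [edgeOp, h]

theorem differential_eq_sum_edgeOp [Fintype E] :
    differential ends r = ∑ e, edgeOp ends r e := by
  refine Finsupp.lhom_ext' fun S => LinearMap.ext_ring ?_
  change differential ends r (Finsupp.single S 1) = (∑ e, edgeOp ends r e) (Finsupp.single S 1)
  rw [differential_single, LinearMap.sum_apply]
  refine Finset.sum_subset_zero_on_sdiff (Finset.subset_univ _) (fun e he => ?_) fun e he => ?_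
  · exact edgeOp_single_of_mem (by simpa using he)
  · exact (edgeOp_single_of_notMem (by simpa using he)).symm

open Classical in
theorem addEdge_eq {e : E} {p q : V} (he : ends e = s(p, q)) (S : ReducedEnhancedState ends r) :
    addEdge S e = if S.IsX p → S.IsX q → (stateGraph ends S.edges).Reachable p q then
      Finsupp.single (S.adjoin e) 1 else 0 := by
  unfold addEdge merge
  simp only [injOn_insert_iff he]
  rfl

theorem addEdge_of {e : E} {p q : V} (he : ends e = s(p, q)) {S : ReducedEnhancedState ends r}
    (h : S.IsX p → S.IsX q → (stateGraph ends S.edges).Reachable p q) :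
    addEdge S e = Finsupp.single (S.adjoin e) 1 := by
  rw [addEdge_eq he, if_pos h]

theorem addEdge_of_not {e : E} {p q : V} (he : ends e = s(p, q)) {S : ReducedEnhancedState ends r}
    (h : ¬ (S.IsX p → S.IsX q → (stateGraph ends S.edges).Reachable p q)) :
    addEdge S e = 0 := by
  rw [addEdge_eq he, if_neg h]

theorem addEdge_eq_single_or_zero (S : ReducedEnhancedState ends r) (e : E) :
    addEdge S e = Finsupp.single (S.adjoin e) 1 ∨ addEdge S e = 0 := by
  unfold addEdge merge
  split_ifs
  · exact Or.inl rfl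
  · exact Or.inr rfl

theorem edgeOp_addEdge_self (S : ReducedEnhancedState ends r) (e : E) :
    edgeOp ends r e (addEdge S e) = 0 := by
  rcases addEdge_eq_single_or_zero S e with h | h
  · rw [h, edgeOp_single_of_mem (Finset.mem_insert_self e S.edges)]
  · rw [h, map_zero]

-- A composite is injective on a set exactly if the first map is injective there and the second is
-- injective on the image. So the two vanishing conditions merge into one that concerns only the
-- total inclusion and is symmetric in `e` and `f`.
open Classical in
theorem edgeOp_addEdge (S : ReducedEnhancedState ends r) {e f : E} (hfe : f ≠ e)
    (hf : f ∉ S.edges) :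
    edgeOp ends r f (addEdge S e) = edgeSign (insert e S.edges) f •
      (if Set.InjOn (componentMap ends ((Finset.subset_insert e S.edges).trans
          (Finset.subset_insert f (insert e S.edges)))) S.colorX then
        Finsupp.single ((S.adjoin e).adjoin f) 1 else 0) := by
  have hc := componentMap_comp (ends := ends) (Finset.subset_insert e S.edges)
    (Finset.subset_insert f (insert e S.edges))
  by_cases h : Set.InjOn (componentMap ends (Finset.subset_insert e S.edges)) S.colorX
  · have h1 : addEdge S e = Finsupp.single (S.adjoin e) 1 := if_pos h
    have hinj : Set.InjOn (componentMap ends (Finset.subset_insert f (S.adjoin e).edges))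
          (S.adjoin e).colorX ↔
        Set.InjOn (componentMap ends ((Finset.subset_insert e S.edges).trans
          (Finset.subset_insert f (insert e S.edges)))) S.colorX := by
      rw [hc]
      exact ⟨fun h' => h'.comp h (Set.mapsTo_image _ _), fun h' => h'.image_of_comp⟩
    rw [h1, edgeOp_single_of_notMem (by simp [edges_adjoin, hfe, hf])]
    unfold addEdge merge
    simp only [hinj]
    rfl
  · have h1 : addEdge S e = 0 := if_neg h
    rw [h1, map_zero, if_neg, smul_zero]
    intro h'
    rw [hc] at h'
    exact h (Set.InjOn.of_comp h')

/-- Both orders give the same state under the same vanishing condition; only the signs differ. Every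
sign rule used below comes from this identity. -/
theorem edgeOp_anticomm (e f : E) (c : Cochains ends r) :
    edgeOp ends r e (edgeOp ends r f c) = - edgeOp ends r f (edgeOp ends r e c) := by
  suffices h : edgeOp ends r e ∘ₗ edgeOp ends r f = -(edgeOp ends r f ∘ₗ edgeOp ends r e) from
    LinearMap.congr_fun h c
  refine Finsupp.lhom_ext' fun S => LinearMap.ext_ring ?_
  change edgeOp ends r e (edgeOp ends r f (Finsupp.single S 1)) =
    -edgeOp ends r f (edgeOp ends r e (Finsupp.single S 1))
  have hmem : ∀ e f : E, e ∈ S.edges → edgeOp ends r e (edgeOp ends r f (Finsupp.single S 1)) = 0 := by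
    intro e f he
    by_cases hf : f ∈ S.edges
    · rw [edgeOp_single_of_mem hf, map_zero]
    · rw [edgeOp_single_of_notMem hf, map_smul]
      rcases addEdge_eq_single_or_zero S f with h | h
      · rw [h, edgeOp_single_of_mem (Finset.mem_insert_of_mem he), smul_zero]
      · rw [h, map_zero, smul_zero]
  by_cases he : e ∈ S.edges
  · rw [hmem e f he, edgeOp_single_of_mem he, map_zero, neg_zero]
  by_cases hf : f ∈ S.edges
  · rw [hmem f e hf, edgeOp_single_of_mem hf, map_zero, neg_zero]
  rw [edgeOp_single_of_notMem he, edgeOp_single_of_notMem hf, map_smul, map_smul]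
  by_cases hef : e = f
  · subst hef
    rw [edgeOp_addEdge_self, smul_zero, neg_zero]
  rw [edgeOp_addEdge S hef he, edgeOp_addEdge S (Ne.symm hef) hf, smul_smul, smul_smul,
    edgeSign_mul_comm hf he (Ne.symm hef), neg_smul, adjoin_comm S f e]
  have h : ∀ {t u : Finset E} (ht : S.edges ⊆ t) (hu : S.edges ⊆ u), t = u →
      (Set.InjOn (componentMap ends ht) S.colorX ↔ Set.InjOn (componentMap ends hu) S.colorX) := by
    rintro t u ht hu rfl
    rfl
  congr 2
  classical
  exact if_congr (h _ _ (Finset.insert_comm e f S.edges)) rfl rfl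

/-- The part of the differential that adds the edges of `D`. -/
noncomputable def partialDifferential (ends : E → Sym2 V) (r : V) (D : Finset E) :
    Cochains ends r →ₗ[ℝ] Cochains ends r :=
  ∑ e ∈ D, edgeOp ends r e

theorem partialDifferential_apply (D : Finset E) (c : Cochains ends r) :
    partialDifferential ends r D c = ∑ e ∈ D, edgeOp ends r e c := by
  rw [partialDifferential, LinearMap.sum_apply]

theorem partialDifferential_edgeOp (D : Finset E) (e : E) (c : Cochains ends r) :
    partialDifferential ends r D (edgeOp ends r e c) =
      -edgeOp ends r e (partialDifferential ends r D c) := by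
  simp only [partialDifferential_apply, map_sum, ← Finset.sum_neg_distrib]
  exact Finset.sum_congr rfl fun f _ => edgeOp_anticomm f e c

theorem edgeOp_edgeOp_self (e : E) (c : Cochains ends r) :
    edgeOp ends r e (edgeOp ends r e c) = 0 :=
  self_eq_neg.1 (edgeOp_anticomm e e c)

theorem partialDifferential_comp_self (D : Finset E) (c : Cochains ends r) :
    partialDifferential ends r D (partialDifferential ends r D c) = 0 := by
  rw [partialDifferential_apply, ← self_eq_neg]
  nth_rw 1 [← partialDifferential_apply, partialDifferential_apply D c, map_sum]
  rw [← Finset.sum_neg_distrib]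
  exact Finset.sum_congr rfl fun e _ => partialDifferential_edgeOp D e c

theorem partialDifferential_insert {D : Finset E} {e : E} (he : e ∉ D) (c : Cochains ends r) :
    partialDifferential ends r (insert e D) c =
      edgeOp ends r e c + partialDifferential ends r D c := by
  simp only [partialDifferential_apply, Finset.sum_insert he]

/-- This and the next lemma reduce claims about cochains to claims about single states in the
support. -/
theorem map_mem_of_mem_supported {α M : Type*} [AddCommGroup M] [Module ℝ M] {A : Set α}
    {N : Submodule ℝ M} (φ : (α →₀ ℝ) →ₗ[ℝ] M) (h : ∀ a ∈ A, φ (Finsupp.single a 1) ∈ N)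
    {c : α →₀ ℝ} (hc : c ∈ Finsupp.supported ℝ ℝ A) : φ c ∈ N := by
  rw [Finsupp.supported_eq_span_single] at hc
  have h1 : Submodule.span ℝ ((fun i => Finsupp.single i (1 : ℝ)) '' A) ≤ N.comap φ := by
    rw [Submodule.span_le]
    rintro _ ⟨a, ha, rfl⟩
    exact h a ha
  exact h1 hc

theorem map_eq_of_mem_supported {α M : Type*} [AddCommGroup M] [Module ℝ M] {A : Set α}
    {φ ψ : (α →₀ ℝ) →ₗ[ℝ] M} (h : ∀ a ∈ A, φ (Finsupp.single a 1) = ψ (Finsupp.single a 1))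
    {c : α →₀ ℝ} (hc : c ∈ Finsupp.supported ℝ ℝ A) : φ c = ψ c := by
  have := map_mem_of_mem_supported (N := ⊥) (φ - ψ)
    (fun a ha => by simp [h a ha]) hc
  rwa [Submodule.mem_bot, LinearMap.sub_apply, sub_eq_zero] at this

end Operators

/-! ### Deletion, contraction and exactness off the diagonal -/

section Exactness

variable {V E : Type*} [LinearOrder E] {ends : E → Sym2 V} {r : V}

/-- The reduced enhanced states of dimension `m` and degree `j` that contain the edges of `F` and
no edges outside of `F ∪ D`. -/
def intervalStates (ends : E → Sym2 V) (r : V) (F D : Finset E) (m j : ℤ) :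
    Set (ReducedEnhancedState ends r) :=
  {S | F ⊆ S.edges ∧ S.edges ⊆ F ∪ D ∧ (S.dimension : ℤ) = m ∧ (S.degree : ℤ) = j}

/-- The cochains on the states that contain the edges of `F` and no edges outside of `F ∪ D`: up
to a shift, the cochains of the multigraph in which `F` is contracted and only `D` is kept. -/
noncomputable abbrev intervalCochains (ends : E → Sym2 V) (r : V) (F D : Finset E) (m j : ℤ) :
    Submodule ℝ (Cochains ends r) :=
  Finsupp.supported ℝ ℝ (intervalStates ends r F D m j)

theorem single_mem_intervalCochains {F D : Finset E} {m j : ℤ} {S : ReducedEnhancedState ends r}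
    (h : S ∈ intervalStates ends r F D m j) : Finsupp.single S 1 ∈ intervalCochains ends r F D m j :=
  Finsupp.single_mem_supported ℝ _ h

theorem edgeOp_mem_of {F D F' D' : Finset E} {m j m' j' : ℤ} {e : E}
    (h : ∀ S ∈ intervalStates ends r F D m j, e ∉ S.edges → (S.adjoin e).degree = S.degree →
      S.adjoin e ∈ intervalStates ends r F' D' m' j')
    {c : Cochains ends r} (hc : c ∈ intervalCochains ends r F D m j) :
    edgeOp ends r e c ∈ intervalCochains ends r F' D' m' j' := by
  refine map_mem_of_mem_supported _ (fun S hS => ?_) hc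
  by_cases he : e ∈ S.edges
  · rw [edgeOp_single_of_mem he]
    exact Submodule.zero_mem _
  · rw [edgeOp_single_of_notMem he]
    refine Submodule.smul_mem _ _ ?_
    obtain ⟨⟨p, q⟩, hpq⟩ := Quot.exists_rep (ends e)
    have hpq : ends e = s(p, q) := hpq.symm
    by_cases hg : S.IsX p → S.IsX q → (stateGraph ends S.edges).Reachable p q
    · rw [addEdge_of hpq hg]
      exact single_mem_intervalCochains (h S hS he (degree_adjoin hpq hg))
    · rw [addEdge_of_not hpq hg]
      exact Submodule.zero_mem _

theorem adjoin_mem_intervalStates {F D : Finset E} {m j : ℤ} {e : E} (he : e ∉ F ∪ D)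
    {S : ReducedEnhancedState ends r} (hS : S ∈ intervalStates ends r F D m j) {j' : ℤ}
    (hj : ((S.adjoin e).degree : ℤ) = j') :
    S.adjoin e ∈ intervalStates ends r (insert e F) D (m + 1) j' := by
  obtain ⟨h1, h2, h3, h4⟩ := hS
  refine ⟨Finset.insert_subset_insert e h1, ?_, ?_, hj⟩
  · rw [Finset.insert_union]
    exact Finset.insert_subset_insert e h2
  · rw [dimension_adjoin fun h => he (h2 h)]
    push_cast
    rw [h3]

theorem edgeOp_mem_insert {F D : Finset E} {m j : ℤ} {e : E} (he : e ∉ F ∪ D)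
    {c : Cochains ends r} (hc : c ∈ intervalCochains ends r F D m j) :
    edgeOp ends r e c ∈ intervalCochains ends r (insert e F) D (m + 1) j := by
  refine edgeOp_mem_of (fun S hS _ hd => adjoin_mem_intervalStates he hS ?_) hc
  rw [hd, hS.2.2.2]

theorem edgeOp_mem {F D : Finset E} {m j : ℤ} {e : E} (he : e ∈ D)
    {c : Cochains ends r} (hc : c ∈ intervalCochains ends r F D m j) :
    edgeOp ends r e c ∈ intervalCochains ends r F D (m + 1) j := by
  refine edgeOp_mem_of (fun S hS hes hd => ?_) hc
  obtain ⟨h1, h2, h3, h4⟩ := hS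
  refine ⟨h1.trans (Finset.subset_insert _ _),
    Finset.insert_subset (Finset.mem_union_right F he) h2, ?_, by rw [hd, h4]⟩
  rw [dimension_adjoin hes]
  push_cast
  rw [h3]

theorem partialDifferential_mem {F D D' : Finset E} {m j : ℤ} (hD : D' ⊆ D)
    {c : Cochains ends r} (hc : c ∈ intervalCochains ends r F D m j) :
    partialDifferential ends r D' c ∈ intervalCochains ends r F D (m + 1) j := by
  rw [partialDifferential_apply]
  exact Submodule.sum_mem _ fun e he => edgeOp_mem (hD he) hc

theorem intervalCochains_le_delete (F D : Finset E) (m j : ℤ) (e : E) :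
    intervalCochains ends r F D m j ≤ intervalCochains ends r F (insert e D) m j :=
  Finsupp.supported_mono fun _ hS =>
    ⟨hS.1, hS.2.1.trans (Finset.union_subset_union_right (Finset.subset_insert e D)), hS.2.2⟩

theorem intervalCochains_le_contract (F D : Finset E) (m j : ℤ) (e : E) :
    intervalCochains ends r (insert e F) D m j ≤ intervalCochains ends r F (insert e D) m j :=
  Finsupp.supported_mono fun _ hS =>
    ⟨(Finset.subset_insert e F).trans hS.1, hS.2.1.trans (by
      rw [Finset.insert_union, Finset.union_insert]), hS.2.2⟩

/-- The cone decomposition: states without `e` form the deletion, states with `e` the contraction.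
-/
theorem exists_add_of_mem_insert {F D : Finset E} {m j : ℤ} {e : E}
    {c : Cochains ends r} (hc : c ∈ intervalCochains ends r F (insert e D) m j) :
    ∃ c₀ ∈ intervalCochains ends r F D m j, ∃ c₁ ∈ intervalCochains ends r (insert e F) D m j,
      c₀ + c₁ = c := by
  rw [← Submodule.mem_sup, ← Finsupp.supported_union]
  refine Finsupp.supported_mono (fun S hS => ?_) hc
  obtain ⟨h1, h2, h3⟩ := hS
  by_cases he : e ∈ S.edges
  · refine Or.inr ⟨Finset.insert_subset he h1, ?_, h3⟩
    rwa [Finset.insert_union, ← Finset.union_insert]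
  · refine Or.inl ⟨h1, fun f hf => ?_, h3⟩
    have hf' := h2 hf
    rw [Finset.union_insert, Finset.mem_insert] at hf'
    exact hf'.resolve_left fun h => he (h ▸ hf)

theorem eq_zero_of_add_eq_zero {F D : Finset E} {m j m' j' : ℤ} {e : E} (he : e ∉ F ∪ D)
    {c₀ c₁ : Cochains ends r} (h₀ : c₀ ∈ intervalCochains ends r F D m j)
    (h₁ : c₁ ∈ intervalCochains ends r (insert e F) D m' j') (h : c₀ + c₁ = 0) :
    c₀ = 0 ∧ c₁ = 0 := by
  have hd : Disjoint (intervalCochains ends r F D m j)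
      (intervalCochains ends r (insert e F) D m' j') := by
    refine Finsupp.disjoint_supported_supported (Set.disjoint_left.2 fun S hS hS' => ?_)
    exact he (hS.2.1 (hS'.1 (Finset.mem_insert_self e F)))
  have h0 : c₀ = 0 := by
    refine Submodule.disjoint_def.1 hd _ h₀ ?_
    rw [eq_neg_of_add_eq_zero_left h]
    exact Submodule.neg_mem _ h₁
  exact ⟨h0, by rwa [h0, zero_add] at h⟩

theorem erase_mem_intervalStates {F D : Finset E} {m j : ℤ} {e : E} (he : e ∉ F ∪ D)
    {T : ReducedEnhancedState ends r} (hT : T ∈ intervalStates ends r (insert e F) D m j)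
    {S : ReducedEnhancedState ends r} (hS : S.edges = T.edges.erase e) {j' : ℤ}
    (hj : (S.degree : ℤ) = j') : S ∈ intervalStates ends r F D (m - 1) j' := by
  obtain ⟨h1, h2, h3, -⟩ := hT
  have heF : e ∉ F := fun h => he (Finset.mem_union_left D h)
  have heT : e ∈ T.edges := h1 (Finset.mem_insert_self e F)
  refine ⟨?_, ?_, ?_, hj⟩
  · rw [hS, ← Finset.erase_insert heF]
    exact Finset.erase_subset_erase e h1
  · rw [hS, ← Finset.erase_insert he, ← Finset.insert_union]
    exact Finset.erase_subset_erase e h2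
  · have := Finset.card_erase_add_one heT
    rw [← hS] at this
    rw [← h3]
    unfold dimension
    omega

theorem reachable_erase {F D : Finset E} {m j : ℤ} {e : E} (he : e ∉ F ∪ D)
    {T : ReducedEnhancedState ends r} (hT : T ∈ intervalStates ends r (insert e F) D m j)
    {v w : V} (h : (stateGraph ends F).Reachable v w) :
    (stateGraph ends (T.edges.erase e)).Reachable v w := by
  refine reachable_stateGraph_mono ?_ h
  rw [← Finset.erase_insert fun h => he (Finset.mem_union_left D h)]
  exact Finset.erase_subset_erase e hT.1

/-- An edge at the component of the base point acts surjectively. -/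
theorem exists_edgeOp_eq {F D : Finset E} {m j : ℤ} {e : E} {p q : V} (hpq : ends e = s(p, q))
    (he : e ∉ F ∪ D) (hp : (stateGraph ends F).Reachable p r)
    {c : Cochains ends r} (hc : c ∈ intervalCochains ends r (insert e F) D m j) :
    ∃ u ∈ intervalCochains ends r F D (m - 1) j, edgeOp ends r e u = c := by
  refine ⟨signedMap e (split e q) c, ?_, ?_⟩
  · refine map_mem_of_mem_supported _ (fun T hT => ?_) hc
    rw [signedMap_single]
    refine Submodule.smul_mem _ _ (single_mem_intervalCochains
      (erase_mem_intervalStates he hT (edges_split e q T) ?_))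
    have heT : e ∈ T.edges := hT.1 (Finset.mem_insert_self e F)
    have hpT := reachable_erase he hT hp
    rw [← hT.2.2.2, ← degree_adjoin hpq fun _ => split_injective_condition hpT,
      adjoin_split hpq heT hpT]
  · refine map_eq_of_mem_supported (φ := edgeOp ends r e ∘ₗ signedMap e (split e q))
      (ψ := LinearMap.id) (fun T hT => ?_) hc
    have heT : e ∈ T.edges := hT.1 (Finset.mem_insert_self e F)
    have hpT := reachable_erase he hT hp
    rw [LinearMap.comp_apply, signedMap_single, map_smul, edgeOp_single_of_notMem
      (by rw [edges_split]; exact Finset.notMem_erase e _),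
      addEdge_of hpq fun _ => split_injective_condition hpT, adjoin_split hpq heT hpT, smul_smul,
      edges_split, edgeSign_erase_self, edgeSign_mul_self, one_smul, LinearMap.id_apply]

/-- Injectivity of `d_e` on states where `e` never meets two different `x`-components. It serves
twice: for loops, and for the states in which `q` has colour `1`. -/
theorem signedMap_split_edgeOp {A : Set (ReducedEnhancedState ends r)} {e : E} {p q : V}
    (hpq : ends e = s(p, q)) (he : ∀ S ∈ A, e ∉ S.edges)
    (hp : ∀ S ∈ A, (stateGraph ends S.edges).Reachable p r)
    (hq : ∀ S ∈ A, S.IsX q → (stateGraph ends S.edges).Reachable p q)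
    {c : Cochains ends r} (hc : c ∈ Finsupp.supported ℝ ℝ A) :
    signedMap e (split e q) (edgeOp ends r e c) = c := by
  refine map_eq_of_mem_supported (φ := signedMap e (split e q) ∘ₗ edgeOp ends r e)
    (ψ := LinearMap.id) (fun S hS => ?_) hc
  rw [LinearMap.comp_apply, edgeOp_single_of_notMem (he S hS), map_smul,
    addEdge_of hpq fun _ => hq S hS, signedMap_single, smul_smul, edges_adjoin,
    edgeSign_insert_self, edgeSign_mul_self, one_smul,
    split_adjoin hpq (he S hS) (hp S hS) (hq S hS), LinearMap.id_apply]

/-- The states of `intervalStates` in which the vertex `q` has colour `x`. -/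
def intervalStatesX (ends : E → Sym2 V) (r : V) (F D : Finset E) (q : V) (m j : ℤ) :
    Set (ReducedEnhancedState ends r) :=
  {S | S ∈ intervalStates ends r F D m j ∧ S.IsX q}

theorem reachable_of_mem_intervalStates {F D : Finset E} {m j : ℤ}
    {S : ReducedEnhancedState ends r} (hS : S ∈ intervalStates ends r F D m j) {v w : V}
    (h : (stateGraph ends F).Reachable v w) : (stateGraph ends S.edges).Reachable v w :=
  reachable_stateGraph_mono hS.1 h

/-- Here `p` shares the colour `x` of the base point and the bridge keeps `p` and `q` in different
components, so adding `e` is the case `x * x = 0`. -/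
theorem edgeOp_eq_zero_of_isX {F D : Finset E} {m j : ℤ} {e : E} {p q : V}
    (hpq : ends e = s(p, q)) (he : e ∉ F ∪ D) (hp : (stateGraph ends F).Reachable p r)
    (hbr : ¬ (stateGraph ends (F ∪ D)).Reachable p q)
    {c : Cochains ends r} (hc : c ∈ Finsupp.supported ℝ ℝ (intervalStatesX ends r F D q m j)) :
    edgeOp ends r e c = 0 := by
  refine map_eq_of_mem_supported (φ := edgeOp ends r e) (ψ := 0) (fun S hS => ?_) hc
  rw [edgeOp_single_of_notMem fun h => he (hS.1.2.1 h), addEdge_of_not hpq, smul_zero,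
    LinearMap.zero_apply]
  intro h
  exact hbr (reachable_stateGraph_mono hS.1.2.1
    (h (S.isX_base.congr (reachable_of_mem_intervalStates hS.1 hp).symm) hS.2))

/-- Split the cochain by the colour of `q`. The part of colour `x` is killed by `d_e`, and on the
part of colour `1` the map `d_e` is injective, so that part is zero. -/
theorem mem_supported_isX_of_edgeOp_eq_zero {F D : Finset E} {m j : ℤ} {e : E} {p q : V}
    (hpq : ends e = s(p, q)) (he : e ∉ F ∪ D) (hp : (stateGraph ends F).Reachable p r)
    (hbr : ¬ (stateGraph ends (F ∪ D)).Reachable p q)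
    {c : Cochains ends r} (hc : c ∈ intervalCochains ends r F D m j)
    (hz : edgeOp ends r e c = 0) :
    c ∈ Finsupp.supported ℝ ℝ (intervalStatesX ends r F D q m j) := by
  have hc' : c ∈ Finsupp.supported ℝ ℝ (intervalStatesX ends r F D q m j) ⊔
      Finsupp.supported ℝ ℝ {S | S ∈ intervalStates ends r F D m j ∧ ¬ S.IsX q} := by
    rw [← Finsupp.supported_union]
    refine Finsupp.supported_mono (fun S hS => ?_) hc
    by_cases h : S.IsX q
    · exact Or.inl ⟨hS, h⟩
    · exact Or.inr ⟨hS, h⟩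
  obtain ⟨a, ha, b, hb, rfl⟩ := Submodule.mem_sup.1 hc'
  have ha0 : edgeOp ends r e a = 0 := edgeOp_eq_zero_of_isX hpq he hp hbr ha
  have hb0 : b = 0 := by
    rw [map_add, ha0, zero_add] at hz
    rw [← signedMap_split_edgeOp hpq (fun S hS h => he (hS.1.2.1 h))
      (fun S hS => reachable_of_mem_intervalStates hS.1 hp) (fun S hS h => absurd h hS.2) hb,
      hz, map_zero]
  rwa [hb0, add_zero]

/-! ### For a bridge, the kernel is isomorphic to the contraction complex -/

section Bridge

variable {F D : Finset E} {m j : ℤ} {e : E} {p q : V}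

theorem signedMap_detach_mem [Finite V] (hpq : ends e = s(p, q)) (he : e ∉ F ∪ D)
    (hp : (stateGraph ends F).Reachable p r)
    (hbr : ¬ (stateGraph ends (F ∪ D)).Reachable p q)
    {c : Cochains ends r} (hc : c ∈ intervalCochains ends r (insert e F) D m j) :
    signedMap e (detach e) c ∈
      Finsupp.supported ℝ ℝ (intervalStatesX ends r F D q (m - 1) (j + 1)) := by
  refine map_mem_of_mem_supported _ (fun T hT => ?_) hc
  rw [signedMap_single]
  have heT : e ∈ T.edges := hT.1 (Finset.mem_insert_self e F)
  have hpT := reachable_erase he hT hp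
  have hpX : T.IsX p :=
    T.isX_base.congr (reachable_stateGraph_mono (Finset.erase_subset e _) hpT.symm)
  have hqX : T.IsX q := hpX.congr (reachable_of_mem hpq heT)
  have hsub : (T.detach e).edges ⊆ F ∪ D :=
    (erase_mem_intervalStates he hT (edges_detach e T) rfl).2.1
  have hdeg := degree_adjoin_add_one hpq (S := T.detach e) (isX_detach.2 hpX) (isX_detach.2 hqX)
    fun h => hbr (reachable_stateGraph_mono hsub h)
  rw [adjoin_detach hpq heT] at hdeg
  refine Submodule.smul_mem _ _ (Finsupp.single_mem_supported ℝ _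
    ⟨erase_mem_intervalStates he hT (edges_detach e T) ?_, isX_detach.2 hqX⟩)
  rw [← hdeg, ← hT.2.2.2]
  push_cast
  rfl

theorem signedMap_adjoin_mem [Finite V] (hpq : ends e = s(p, q)) (he : e ∉ F ∪ D)
    (hp : (stateGraph ends F).Reachable p r)
    (hbr : ¬ (stateGraph ends (F ∪ D)).Reachable p q)
    {c : Cochains ends r} (hc : c ∈ Finsupp.supported ℝ ℝ (intervalStatesX ends r F D q m j)) :
    signedMap e (adjoin e) c ∈ intervalCochains ends r (insert e F) D (m + 1) (j - 1) := by
  refine map_mem_of_mem_supported _ (fun S hS => ?_) hc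
  rw [signedMap_single]
  refine Submodule.smul_mem _ _ (single_mem_intervalCochains
    (adjoin_mem_intervalStates he hS.1 ?_))
  have hdeg := degree_adjoin_add_one hpq
    (S.isX_base.congr (reachable_of_mem_intervalStates hS.1 hp).symm) hS.2
    fun h => hbr (reachable_stateGraph_mono hS.1.2.1 h)
  rw [← hS.1.2.2.2, ← hdeg]
  push_cast
  ring

theorem signedMap_detach_adjoin (hpq : ends e = s(p, q)) (he : e ∉ F ∪ D)
    (hp : (stateGraph ends F).Reachable p r)
    {c : Cochains ends r} (hc : c ∈ Finsupp.supported ℝ ℝ (intervalStatesX ends r F D q m j)) :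
    signedMap e (detach e) (signedMap e (adjoin e) c) = c := by
  refine map_eq_of_mem_supported (φ := signedMap e (detach e) ∘ₗ signedMap e (adjoin e))
    (ψ := LinearMap.id) (fun S hS => ?_) hc
  rw [LinearMap.comp_apply, signedMap_single, map_smul, signedMap_single, smul_smul, edges_adjoin,
    edgeSign_insert_self, edgeSign_mul_self, one_smul, LinearMap.id_apply,
    detach_adjoin hpq (fun h => he (hS.1.2.1 h))
      (S.isX_base.congr (reachable_of_mem_intervalStates hS.1 hp).symm) hS.2]

theorem signedMap_adjoin_detach (hpq : ends e = s(p, q))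
    {c : Cochains ends r} (hc : c ∈ intervalCochains ends r (insert e F) D m j) :
    signedMap e (adjoin e) (signedMap e (detach e) c) = c := by
  refine map_eq_of_mem_supported (φ := signedMap e (adjoin e) ∘ₗ signedMap e (detach e))
    (ψ := LinearMap.id) (fun T hT => ?_) hc
  rw [LinearMap.comp_apply, signedMap_single, map_smul, signedMap_single, smul_smul, edges_detach,
    edgeSign_erase_self, edgeSign_mul_self, one_smul, LinearMap.id_apply,
    adjoin_detach hpq (hT.1 (Finset.mem_insert_self e F))]

/-- If the edge `e` is a bridge at the component of the base point, then the restriction of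
`adjoin e` to the states with endpoints of colour `x` anticommutes with the differential. -/
theorem edgeOp_signedMap_adjoin (hpq : ends e = s(p, q)) (he : e ∉ F ∪ D)
    (hp : (stateGraph ends F).Reachable p r)
    (hbr : ¬ (stateGraph ends (F ∪ D)).Reachable p q) {f : E} (hf : f ∈ D)
    {c : Cochains ends r} (hc : c ∈ Finsupp.supported ℝ ℝ (intervalStatesX ends r F D q m j)) :
    edgeOp ends r f (signedMap e (adjoin e) c) = -signedMap e (adjoin e) (edgeOp ends r f c) := by
  refine map_eq_of_mem_supported (φ := edgeOp ends r f ∘ₗ signedMap e (adjoin e))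
    (ψ := -(signedMap e (adjoin e) ∘ₗ edgeOp ends r f)) (fun S hS => ?_) hc
  have hef : e ≠ f := by
    rintro rfl
    exact he (Finset.mem_union_right F hf)
  have heS : e ∉ S.edges := fun h => he (hS.1.2.1 h)
  rw [LinearMap.neg_apply, LinearMap.comp_apply, LinearMap.comp_apply, signedMap_single, map_smul]
  by_cases hfS : f ∈ S.edges
  · rw [edgeOp_single_of_mem hfS, edgeOp_single_of_mem (Finset.mem_insert_of_mem hfS), smul_zero,
      map_zero, neg_zero]
  rw [edgeOp_single_of_notMem hfS, edgeOp_single_of_notMem (by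
    rw [edges_adjoin, Finset.mem_insert, not_or]
    exact ⟨hef.symm, hfS⟩), map_smul, smul_smul, edges_adjoin, edgeSign_mul_comm heS hfS hef,
    neg_smul]
  refine congrArg Neg.neg ?_
  obtain ⟨⟨u, w⟩, huw⟩ := Quot.exists_rep (ends f)
  have huw : ends f = s(u, w) := huw.symm
  have hpX : S.IsX p := S.isX_base.congr (reachable_of_mem_intervalStates hS.1 hp).symm
  -- Whether adding `f` gives zero depends on the colours and the connection of its endpoints `u`
  -- and `w`; `hX` and `hR` show that neither changes when `e` is present.
  have hX : ∀ v, (S.adjoin e).IsX v ↔ S.IsX v := fun v => by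
    rw [← isX_detach (e := e), detach_adjoin hpq heS hpX hS.2]
  -- If `e` newly connected `u` with `w`, going around through `f` would connect `p` with `q` inside
  -- `F ∪ D`, so `e` would not be a bridge.
  have hR : (stateGraph ends (S.adjoin e).edges).Reachable u w ↔
      (stateGraph ends S.edges).Reachable u w := by
    have hsub : insert f S.edges ⊆ F ∪ D :=
      Finset.insert_subset (Finset.mem_union_right F hf) hS.1.2.1
    have hm : ∀ {x y : V}, (stateGraph ends S.edges).Reachable x y →
        (stateGraph ends (F ∪ D)).Reachable x y :=
      fun h => reachable_stateGraph_mono hS.1.2.1 h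
    have huw' := reachable_of_mem huw (Finset.mem_union_right F hf)
    rw [edges_adjoin, reachable_insert hpq]
    refine ⟨?_, Or.inl⟩
    rintro (h | ⟨h, h'⟩ | ⟨h, h'⟩)
    · exact h
    · exact absurd ((hm h).symm.trans (huw'.trans (hm h').symm)) hbr
    · exact absurd ((hm h').trans (huw'.symm.trans (hm h))) hbr
  by_cases hg : S.IsX u → S.IsX w → (stateGraph ends S.edges).Reachable u w
  · rw [addEdge_of huw hg, addEdge_of huw (by rwa [hX, hX, hR]), signedMap_single, smul_smul,
      adjoin_comm S e f, edges_adjoin]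
  · rw [addEdge_of_not huw hg, addEdge_of_not huw (by rwa [hX, hX, hR]), map_zero, smul_zero,
      smul_zero]

end Bridge

/-- The complex of `intervalCochains` is exact outside of the diagonal. -/
theorem exists_partialDifferential_eq [Finite V] (D : Finset E) :
    ∀ F : Finset E, Disjoint F D → (∀ v w, (stateGraph ends (F ∪ D)).Reachable v w) →
      ∀ (m j : ℤ), m - F.card + j ≠ numComponents ends F - 1 →
      ∀ c ∈ intervalCochains ends r F D m j, partialDifferential ends r D c = 0 →
        ∃ b ∈ intervalCochains ends r F D (m - 1) j, partialDifferential ends r D b = c := by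
  induction D using Finset.strongInduction with
  | H D ih =>
  intro F hFD hconn m j hmj c hc hdc
  by_cases hex : ∃ e ∈ D, ∃ p q, ends e = s(p, q) ∧ (stateGraph ends F).Reachable p r
  · obtain ⟨e, heD, p, q, hpq, hp⟩ := hex
    obtain ⟨D, he', rfl⟩ : ∃ D', e ∉ D' ∧ insert e D' = D :=
      ⟨D.erase e, Finset.notMem_erase e D, Finset.insert_erase heD⟩
    have hlt : D ⊂ insert e D := Finset.ssubset_insert he'
    have heF : e ∉ F := fun h => Finset.disjoint_left.1 hFD h heD
    have he : e ∉ F ∪ D := by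
      rw [Finset.mem_union, not_or]
      exact ⟨heF, he'⟩
    have hdisj : Disjoint F D := hFD.mono_right hlt.1
    have hdisj' : Disjoint (insert e F) D := Finset.disjoint_insert_left.2 ⟨he', hdisj⟩
    have hconn' : ∀ v w, (stateGraph ends (insert e F ∪ D)).Reachable v w := by
      rwa [Finset.insert_union, ← Finset.union_insert]
    -- Reduction to the kernel of `d_e`: write `c = c₀ + d_e u` by surjectivity. Subtracting the
    -- coboundary of `u` leaves `c₀ - d_D u`, which does not involve `e`.
    suffices key : ∀ c ∈ intervalCochains ends r F D m j, edgeOp ends r e c = 0 →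
        partialDifferential ends r D c = 0 →
        ∃ b ∈ intervalCochains ends r F (insert e D) (m - 1) j,
          partialDifferential ends r (insert e D) b = c by
      obtain ⟨c₀, hc₀, c₁, hc₁, rfl⟩ := exists_add_of_mem_insert hc
      obtain ⟨u, hu, rfl⟩ := exists_edgeOp_eq hpq he hp hc₁
      have hdu : partialDifferential ends r D u ∈ intervalCochains ends r F D m j := by
        have := partialDifferential_mem (Finset.Subset.refl D) hu
        rwa [sub_add_cancel] at this
      have hdz : edgeOp ends r e (c₀ - partialDifferential ends r D u) = 0 ∧
          partialDifferential ends r D (c₀ - partialDifferential ends r D u) = 0 := by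
        rw [partialDifferential_insert he', map_add, map_add, edgeOp_edgeOp_self, add_zero,
          partialDifferential_edgeOp] at hdc
        -- The cocycle equation splits into its parts without and with `e`: `d_D c₀ = 0` and `d_e
        -- (c₀ - d_D u) = 0`.
        have h := eq_zero_of_add_eq_zero he (partialDifferential_mem (Finset.Subset.refl D) hc₀)
          (edgeOp_mem_insert he (Submodule.sub_mem _ hc₀ hdu)) (by
            rw [map_sub, ← hdc]
            abel)
        refine ⟨h.2, ?_⟩
        rw [map_sub, h.1, partialDifferential_comp_self, sub_zero]
      obtain ⟨b, hb, hdb⟩ := key _ (Submodule.sub_mem _ hc₀ hdu) hdz.1 hdz.2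
      refine ⟨b + u, Submodule.add_mem _ hb (intervalCochains_le_delete _ _ _ _ e hu), ?_⟩
      rw [map_add, hdb, partialDifferential_insert he']
      abel
    clear hdc hc c
    intro c hc hec hdc
    -- A loop after contraction of `F`: `d_e` is injective, so its kernel is zero.
    by_cases hloop : (stateGraph ends F).Reachable p q
    · have hc0 : c = 0 := by
        rw [← signedMap_split_edgeOp hpq (fun S hS h => he (hS.2.1 h))
          (fun S hS => reachable_of_mem_intervalStates hS hp)
          (fun S hS _ => reachable_of_mem_intervalStates hS hloop) hc, hec, map_zero]
      exact ⟨0, Submodule.zero_mem _, by rw [hc0, map_zero]⟩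
    have hnum := numComponents_insert hpq hloop
    have hcard := Finset.card_insert_of_notMem heF
    -- Contracting `e` raises the size of `F` by one and lowers the number of components by one, so
    -- the same pairs `(m, j)` lie on the diagonals of deletion and contraction.
    by_cases hbr : (stateGraph ends (F ∪ D)).Reachable p q
    · have hconn₀ : ∀ v w, (stateGraph ends (F ∪ D)).Reachable v w := by
        intro v w
        have h := hconn v w
        rw [Finset.union_insert, reachable_insert hpq] at h
        rcases h with h | ⟨h, h'⟩ | ⟨h, h'⟩
        · exact h
        · exact h.trans (hbr.trans h')
        · exact h.trans (hbr.symm.trans h')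
      obtain ⟨v, hv, rfl⟩ := ih D hlt F hdisj hconn₀ m j hmj c hc hdc
      have hev := edgeOp_mem_insert he hv
      rw [sub_add_cancel] at hev
      -- The primitive `v` in the deletion has an unwanted term `d_e v`. It is a cocycle of the
      -- contraction, hence equals `d_D w`, and `v - w` is a primitive for the full differential.
      obtain ⟨w, hw, hdw⟩ := ih D hlt (insert e F) hdisj' hconn' m j
        (by rw [hcard]; push_cast; omega) (edgeOp ends r e v) hev
        (by rw [partialDifferential_edgeOp, hec, neg_zero])
      have hew : edgeOp ends r e w = 0 := by
        refine map_eq_of_mem_supported (ψ := 0) (fun S hS => ?_) hw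
        rw [edgeOp_single_of_mem (hS.1 (Finset.mem_insert_self e F)), LinearMap.zero_apply]
      refine ⟨v - w, Submodule.sub_mem _ (intervalCochains_le_delete _ _ _ _ e hv)
        (intervalCochains_le_contract _ _ _ _ e hw), ?_⟩
      rw [map_sub, partialDifferential_insert he', partialDifferential_insert he', hdw, hew]
      abel
    -- The deletion is disconnected, so the cocycle is transported to the contraction by `adjoin`,
    -- bounded there by `w`, and the bound is brought back by `detach`.
    · have hcX := mem_supported_isX_of_edgeOp_eq_zero hpq he hp hbr hc hec
      have hanti : ∀ {m j : ℤ} {c : Cochains ends r},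
          c ∈ Finsupp.supported ℝ ℝ (intervalStatesX ends r F D q m j) →
          partialDifferential ends r D (signedMap e (adjoin e) c) =
            -signedMap e (adjoin e) (partialDifferential ends r D c) := by
        intro m j c hc
        simp only [partialDifferential_apply, map_sum, ← Finset.sum_neg_distrib]
        exact Finset.sum_congr rfl fun f hf => edgeOp_signedMap_adjoin hpq he hp hbr hf hc
      have hb := signedMap_adjoin_mem hpq he hp hbr hcX
      obtain ⟨w, hw, hdw⟩ := ih D hlt (insert e F) hdisj' hconn' (m + 1) (j - 1)
        (by rw [hcard]; push_cast; omega) _ hb (by rw [hanti hcX, hdc, map_zero, neg_zero])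
      have hv : signedMap e (detach e) w ∈
          Finsupp.supported ℝ ℝ (intervalStatesX ends r F D q (m - 1) j) := by
        have h := signedMap_detach_mem hpq he hp hbr hw
        rwa [add_sub_cancel_right, sub_add_cancel] at h
      have hvF : signedMap e (detach e) w ∈ intervalCochains ends r F D (m - 1) j :=
        Finsupp.supported_mono (fun S hS => hS.1) hv
      have hev := edgeOp_eq_zero_of_isX hpq he hp hbr hv
      have hdv := mem_supported_isX_of_edgeOp_eq_zero hpq he hp hbr
        (partialDifferential_mem (Finset.Subset.refl D) hvF)
        (by rw [← neg_eq_zero, ← partialDifferential_edgeOp, hev, map_zero])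
      -- Both sides are supported on states with `q` of colour `x`, where `adjoin` is invertible, so
      -- they may be compared after applying it. The minus sign is that of the anticommutation.
      have hkey : partialDifferential ends r D (signedMap e (detach e) w) = -c := by
        rw [← signedMap_detach_adjoin hpq he hp hdv, ← signedMap_detach_adjoin hpq he hp hcX,
          ← map_neg, ← hdw, ← neg_eq_iff_eq_neg.2 (hanti hv), signedMap_adjoin_detach hpq hw]
      refine ⟨-signedMap e (detach e) w,
        Submodule.neg_mem _ (intervalCochains_le_delete _ _ _ _ e hvF), ?_⟩
      rw [map_neg, partialDifferential_insert he', hev, zero_add, hkey, neg_neg]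
  -- Follow a walk back from the base point: an edge of `D` on it would have an endpoint in the base
  -- component of `F`, contrary to `hex`, so the walk never leaves that component.
  · have hF : ∀ v, (stateGraph ends F).Reachable v r := by
      have key : ∀ a b : V, (stateGraph ends (F ∪ D)).Walk a b →
          (stateGraph ends F).Reachable b r → (stateGraph ends F).Reachable a r := by
        intro a b W hb
        induction W with
        | nil => exact hb
        | @cons a b _ hab _ hW =>
          rw [stateGraph, SimpleGraph.fromEdgeSet_adj] at hab
          obtain ⟨⟨f, hf, hfe⟩, -⟩ := hab
          rcases Finset.mem_union.1 (Finset.mem_coe.1 hf) with hf | hf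
          · exact (reachable_of_mem hfe hf).trans (hW hb)
          · exact absurd ⟨f, hf, b, a, hfe.trans Sym2.eq_swap, hW hb⟩ hex
      intro v
      obtain ⟨W⟩ := hconn v r
      exact key v r W (SimpleGraph.Reachable.refl _)
    have hsub : Subsingleton (stateGraph ends F).ConnectedComponent := by
      refine ⟨fun c d => ?_⟩
      induction c using SimpleGraph.ConnectedComponent.ind with
      | h v =>
        induction d using SimpleGraph.ConnectedComponent.ind with
        | h w => exact SimpleGraph.ConnectedComponent.sound ((hF v).trans (hF w).symm)
    have hnum : numComponents ends F = 1 :=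
      Nat.card_eq_one_iff_unique.2 ⟨hsub, ⟨(stateGraph ends F).connectedComponentMk r⟩⟩
    have hD : D = ∅ := by
      refine Finset.eq_empty_of_forall_notMem fun e he => hex ?_
      obtain ⟨⟨u, w⟩, huw⟩ := Quot.exists_rep (ends e)
      exact ⟨e, he, u, w, huw.symm, hF u⟩
    -- The only possible state has edge set `F`, one component and degree `0`; it lies on the
    -- diagonal, which `hmj` excludes.
    have hempty : intervalStates ends r F D m j = ∅ := by
      refine Set.eq_empty_of_forall_notMem ?_
      rintro ⟨s, X, hX⟩ ⟨h1, h2, h3, h4⟩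
      rw [hD, Finset.union_empty] at h2
      obtain rfl : s = F := Finset.Subset.antisymm h2 h1
      have hdeg : X.ncard ≤ 1 := Set.ncard_le_one_of_subsingleton X
      change ((s.card : ℕ) : ℤ) = m at h3
      change ((X.ncard - 1 : ℕ) : ℤ) = j at h4
      omega
    rw [intervalCochains, hempty, Finsupp.supported_empty, Submodule.mem_bot] at hc
    exact ⟨0, Submodule.zero_mem _, by rw [hc, map_zero]⟩

end Exactness

/-! ### The Euler characteristic computed on cochains -/

section EulerCharacteristic

variable {V E : Type*} {ends : E → Sym2 V} {r : V}

theorem partialDifferential_univ [Fintype E] [LinearOrder E] :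
    partialDifferential ends r univ = differential ends r :=
  differential_eq_sum_edgeOp.symm

theorem intervalCochains_empty_univ [Fintype E] [LinearOrder E] (i j : ℕ) :
    intervalCochains ends r ∅ univ i j = cochainGroup ends r i j := by
  unfold intervalCochains cochainGroup intervalStates
  congr 1
  ext S
  simp

theorem stateGraph_empty : stateGraph ends ∅ = ⊥ := by
  simp [stateGraph]

theorem numComponents_empty [Fintype V] : numComponents ends ∅ = Fintype.card V := by
  rw [numComponents, ← Nat.card_eq_fintype_card]
  refine (Nat.card_congr (Equiv.ofBijective (stateGraph ends ∅).connectedComponentMk ⟨?_, ?_⟩)).symm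
  · intro v w h
    rw [SimpleGraph.ConnectedComponent.eq, stateGraph_empty, SimpleGraph.reachable_bot] at h
    exact h
  · intro c
    induction c using SimpleGraph.ConnectedComponent.ind with
    | h v => exact ⟨v, rfl⟩

/-- The reduced cohomology of a connected multigraph is concentrated on the diagonal. -/
theorem subsingleton_reducedCohomology [Fintype V] [Fintype E] [LinearOrder E]
    (hconn : ∀ v w, (stateGraph ends univ).Reachable v w) {i j : ℕ}
    (hij : i + j ≠ Fintype.card V - 1) : Subsingleton (ReducedCohomology ends r i j) := by
  rw [ReducedCohomology, Submodule.Quotient.subsingleton_iff, Submodule.submoduleOf_eq_top]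
  rintro ⟨c, hc⟩ hdc
  have hdc' : differential ends r c = 0 := congrArg Subtype.val hdc
  have hn : 0 < Fintype.card V := Fintype.card_pos_iff.2 ⟨r⟩
  obtain ⟨b, hb, hdb⟩ := exists_partialDifferential_eq univ ∅ (Finset.disjoint_empty_left _)
    (by rwa [Finset.empty_union]) i j
    (by
      rw [numComponents_empty, Finset.card_empty]
      push_cast
      omega) c
    (by rwa [intervalCochains_empty_univ]) (by rw [partialDifferential_univ, hdc'])
  rw [partialDifferential_univ] at hdb
  cases i with
  | zero =>
    have hb0 : b = 0 := by
      -- With integer indices the primitive of a cocycle of dimension `0` has dimension `-1`, where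
      -- there are no states; this matches the convention `C^{-1,j} = 0`.
      have hempty : intervalStates ends r ∅ univ (((0 : ℕ) : ℤ) - 1) j = ∅ := by
        refine Set.eq_empty_of_forall_notMem ?_
        rintro S ⟨-, -, h, -⟩
        omega
      rwa [intervalCochains, hempty, Finsupp.supported_empty, Submodule.mem_bot] at hb
    rw [hb0, map_zero] at hdb
    exact (Submodule.mem_bot ℝ).2 (Subtype.ext hdb.symm)
  | succ i =>
    have hb' : b ∈ cochainGroup ends r i j := by
      rw [← intervalCochains_empty_univ]
      convert hb using 2
      push_cast
      ring
    exact ⟨⟨b, hb'⟩, Subtype.ext hdb⟩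

instance [Finite V] [Finite E] : Finite (ReducedEnhancedState ends r) :=
  Finite.of_injective (fun S : ReducedEnhancedState ends r => (S.edges, {v | S.IsX v}))
    fun _ _ h => ext_isX (congrArg Prod.fst h) fun v => Set.ext_iff.1 (congrArg Prod.snd h) v

theorem finrank_cochainGroup [Finite V] [Finite E] (i j : ℕ) :
    Module.finrank ℝ (cochainGroup ends r i j) =
      Nat.card {S : ReducedEnhancedState ends r // S.dimension = i ∧ S.degree = j} := by
  have := Fintype.ofFinite {S : ReducedEnhancedState ends r | S.dimension = i ∧ S.degree = j}
  rw [cochainGroup, (Finsupp.supportedEquivFinsupp _).finrank_eq, Module.finrank_finsupp_self]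
  exact Nat.card_eq_fintype_card.symm

theorem finrank_reducedCohomology [Finite V] [Fintype E] [LinearOrder E] (i j : ℕ) :
    Module.finrank ℝ (ReducedCohomology ends r i j) +
        (Module.finrank ℝ (coboundaries ends r i j) +
          Module.finrank ℝ (coboundaries ends r (i + 1) j)) =
      Module.finrank ℝ (cochainGroup ends r i j) := by
  have h1 := Submodule.finrank_quotient_add_finrank
    ((coboundaries ends r i j).submoduleOf (LinearMap.ker (differentialAt ends r i j)))
  have h2 := (Submodule.submoduleOfEquivOfLe (coboundaries_le_ker ends r i j)).finrank_eq
  have h3 := LinearMap.finrank_range_add_finrank_ker (differentialAt ends r i j)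
  have h4 : Module.finrank ℝ (coboundaries ends r (i + 1) j) =
    Module.finrank ℝ (LinearMap.range (differentialAt ends r i j)) := rfl
  change Module.finrank ℝ (ReducedCohomology ends r i j) + _ = _ at h1
  omega

/-- By rank-nullity each rank of a differential is counted in two adjacent dimensions with opposite
signs. The sum telescopes, leaving only the rank of the map into dimension `N`. -/
theorem sum_finrank_reducedCohomology [Finite V] [Fintype E] [LinearOrder E] (N j : ℕ) :
    ∑ i ∈ range N, (-1 : ℤ) ^ i * Module.finrank ℝ (ReducedCohomology ends r i j) =
      ∑ i ∈ range N, (-1 : ℤ) ^ i * Module.finrank ℝ (cochainGroup ends r i j) +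
        (-1) ^ N * Module.finrank ℝ (coboundaries ends r N j) := by
  induction N with
  | zero =>
    have : Module.finrank ℝ (coboundaries ends r 0 j) = 0 := finrank_bot _ _
    simp [this]
  | succ N ih =>
    rw [Finset.sum_range_succ, Finset.sum_range_succ, ih, ← finrank_reducedCohomology N j]
    push_cast
    ring

theorem cochainGroup_eq_bot [Fintype E] {i : ℕ} (h : Fintype.card E < i) (j : ℕ) :
    cochainGroup ends r i j = ⊥ := by
  have hempty : {S : ReducedEnhancedState ends r | S.dimension = i ∧ S.degree = j} = ∅ := by
    refine Set.eq_empty_of_forall_notMem ?_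
    rintro S ⟨hS, -⟩
    have : S.dimension ≤ Fintype.card E := Finset.card_le_univ S.edges
    omega
  rw [cochainGroup, hempty, Finsupp.supported_empty]

/-- The Euler characteristic in degree `j` can be computed from the cochain groups. -/
theorem sum_finrank_reducedCohomology_eq [Finite V] [Fintype E] [LinearOrder E] (j : ℕ) :
    ∑ i ∈ range (Fintype.card E + 1),
        (-1 : ℤ) ^ i * Module.finrank ℝ (ReducedCohomology ends r i j) =
      ∑ i ∈ range (Fintype.card E + 1),
        (-1 : ℤ) ^ i * Module.finrank ℝ (cochainGroup ends r i j) := by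
  have h := finrank_reducedCohomology (ends := ends) (r := r) (Fintype.card E + 1) j
  have h0 : Module.finrank ℝ (cochainGroup ends r (Fintype.card E + 1) j) = 0 := by
    rw [cochainGroup_eq_bot (Nat.lt_succ_self _) j, finrank_bot]
  rw [sum_finrank_reducedCohomology, show Module.finrank ℝ
    (coboundaries ends r (Fintype.card E + 1) j) = 0 by omega]
  simp

theorem finrank_reducedCohomology_eq_zero [Finite V] [Fintype E] [LinearOrder E] {i : ℕ}
    (h : Fintype.card E < i) (j : ℕ) : Module.finrank ℝ (ReducedCohomology ends r i j) = 0 := by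
  have h1 := finrank_reducedCohomology (ends := ends) (r := r) i j
  have h0 : Module.finrank ℝ (cochainGroup ends r i j) = 0 := by
    rw [cochainGroup_eq_bot h j, finrank_bot]
  omega

theorem degree_lt [Fintype V] (S : ReducedEnhancedState ends r) : S.degree < Fintype.card V := by
  have h1 : S.colorX.ncard ≤ Nat.card (stateGraph ends S.edges).ConnectedComponent :=
    Set.ncard_le_card _
  have h2 : Nat.card (stateGraph ends S.edges).ConnectedComponent ≤ Nat.card V :=
    Nat.card_le_card_of_surjective _ Quot.mk_surjective
  have hn : 0 < Fintype.card V := Fintype.card_pos_iff.2 ⟨r⟩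
  rw [Nat.card_eq_fintype_card (α := V)] at h2
  unfold degree
  omega

open Polynomial in
/-- The sum over the sets that contain a given element. -/
theorem sum_pow_ncard {α : Type*} [Fintype α] (a : α) [Fintype {A : Set α // a ∈ A}] :
    ∑ A : {A : Set α // a ∈ A}, (X : ℤ[X]) ^ (A.1.ncard - 1) =
      (1 + X) ^ (Fintype.card α - 1) := by
  classical
  -- Removing `a` turns the sets that contain it into arbitrary subsets of the rest, and the sum
  -- over these is the expansion of a product of factors `1 + X`.
  have h : ∑ Y ∈ ((univ : Finset α).erase a).powerset, (X : ℤ[X]) ^ Y.card =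
      (1 + X) ^ (Fintype.card α - 1) := by
    have := Finset.prod_one_add (f := fun _ : α => (X : ℤ[X])) (univ.erase a)
    simp only [Finset.prod_const] at this
    rw [← this, Finset.card_erase_of_mem (Finset.mem_univ a), Finset.card_univ]
  rw [← h]
  refine Finset.sum_bij' (fun A _ => A.1.toFinset.erase a)
    (fun Y _ => ⟨((insert a Y : Finset α) : Set α), by simp⟩) ?_ ?_ ?_ ?_ ?_
  · intro A _
    exact Finset.mem_powerset.2 (Finset.erase_subset_erase a (Finset.subset_univ _))
  · intro Y _
    exact Finset.mem_univ _
  · intro A _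
    refine Subtype.ext ?_
    change ((insert a (A.1.toFinset.erase a) : Finset α) : Set α) = A.1
    rw [Finset.insert_erase (Set.mem_toFinset.2 A.2), Set.coe_toFinset]
  · intro Y hY
    have haY : a ∉ Y := fun h => Finset.notMem_erase a univ (Finset.mem_powerset.1 hY h)
    simp [haY]
  · intro A _
    rw [Finset.card_erase_of_mem (Set.mem_toFinset.2 A.2), Set.ncard_eq_toFinset_card']

/-- A reduced enhanced state is a state with a set of components that contains the component of
the base point. -/
def stateEquiv (ends : E → Sym2 V) (r : V) : ReducedEnhancedState ends r ≃
    Σ s : Finset E, {X : Set (stateGraph ends s).ConnectedComponent //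
      (stateGraph ends s).connectedComponentMk r ∈ X} where
  toFun S := ⟨S.edges, S.colorX, S.base_mem⟩
  invFun p := ⟨p.1, p.2.1, p.2.2⟩
  left_inv _ := rfl
  right_inv _ := rfl

-- The states are grouped by their edge set. The free choice is then the set of components coloured
-- `x` besides the base component, and each component other than the base one contributes a factor
-- `1 + X`.
open Polynomial in
theorem sum_finrank_cochainGroup [Fintype V] [Fintype E] :
    ∑ i ∈ range (Fintype.card E + 1), ∑ j ∈ range (Fintype.card V),
        (-1) ^ i * (X : ℤ[X]) ^ j * (Module.finrank ℝ (cochainGroup ends r i j) : ℤ[X]) =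
      ∑ s : Finset E, (-1) ^ s.card * (1 + X) ^ (numComponents ends s - 1) := by
  classical
  have := Fintype.ofFinite (ReducedEnhancedState ends r)
  have h1 : ∀ i j : ℕ, (-1) ^ i * (X : ℤ[X]) ^ j *
      (Module.finrank ℝ (cochainGroup ends r i j) : ℤ[X]) =
      ∑ S : ReducedEnhancedState ends r with (S.dimension, S.degree) = (i, j),
        (-1) ^ S.dimension * X ^ S.degree := by
    intro i j
    rw [Finset.sum_congr rfl (g := fun _ => (-1) ^ i * (X : ℤ[X]) ^ j), Finset.sum_const,
      finrank_cochainGroup, Nat.card_eq_fintype_card, Fintype.card_subtype, nsmul_eq_mul, mul_comm]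
    · simp only [Prod.mk.injEq]
    · intro S hS
      have := (Finset.mem_filter.1 hS).2
      rw [Prod.mk.injEq] at this
      rw [this.1, this.2]
  simp only [h1]
  rw [← Finset.sum_product', Finset.sum_fiberwise_of_maps_to]
  · rw [← (stateEquiv ends r).symm.sum_comp, Fintype.sum_sigma]
    refine Finset.sum_congr rfl fun s _ => ?_
    rw [numComponents, Nat.card_eq_fintype_card,
      ← sum_pow_ncard ((stateGraph ends s).connectedComponentMk r), Finset.mul_sum]
    rfl
  · intro S _
    rw [Finset.mem_product, Finset.mem_range, Finset.mem_range]
    exact ⟨Nat.lt_succ_of_le (Finset.card_le_univ S.edges), degree_lt S⟩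

end EulerCharacteristic

/-! ### Whitney's subgraph expansion of the chromatic polynomial -/

section Whitney

variable {V : Type*}

/-- A labelling that agrees across every edge of `s` is the same as a labelling of the components of
`s`. -/
theorem card_constant_on_components {E : Type*} (ends : E → Sym2 V) [Finite V] (s : Finset E)
    (k : ℕ) : Nat.card {f : V → Fin k // ∀ e ∈ s, ((ends e).map f).IsDiag} =
      k ^ numComponents ends s := by
  have hwalk : ∀ (f : {f : V → Fin k // ∀ e ∈ s, ((ends e).map f).IsDiag}) (v w : V),
      (stateGraph ends s).Walk v w → f.1 v = f.1 w := by
    intro f v w W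
    induction W with
    | nil => rfl
    | @cons a b c hab _ ih =>
      rw [stateGraph, SimpleGraph.fromEdgeSet_adj] at hab
      obtain ⟨⟨e, he, heq⟩, -⟩ := hab
      have h := f.2 e he
      rw [heq, Sym2.map_mk, Sym2.mk_isDiag_iff] at h
      exact h.trans ih
  have e : {f : V → Fin k // ∀ e ∈ s, ((ends e).map f).IsDiag} ≃
      ((stateGraph ends s).ConnectedComponent → Fin k) :=
    { toFun := fun f => SimpleGraph.ConnectedComponent.lift f.1 fun v w W _ => hwalk f v w W
      invFun := fun g => ⟨fun v => g ((stateGraph ends s).connectedComponentMk v), by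
        intro e he
        obtain ⟨⟨p, q⟩, hpq⟩ := Quot.exists_rep (ends e)
        have hpq : ends e = s(p, q) := hpq.symm
        rw [hpq, Sym2.map_mk, Sym2.mk_isDiag_iff]
        exact congrArg g (SimpleGraph.ConnectedComponent.sound (reachable_of_mem hpq he))⟩
      left_inv := fun f => rfl
      right_inv := fun g => by
        ext c
        induction c using SimpleGraph.ConnectedComponent.ind
        rfl }
  have := Fintype.ofFinite (stateGraph ends s).ConnectedComponent
  rw [Nat.card_congr e, Nat.card_fun, Nat.card_fin, numComponents]

open Polynomial in
/-- Whitney's expansion of the chromatic polynomial over the spanning subgraphs. -/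
theorem chromaticPolynomial_eq_sum [Fintype V] (G : SimpleGraph V) [Fintype G.edgeSet] :
    chromaticPolynomial G = ∑ s : Finset G.edgeSet,
      (-1) ^ s.card * X ^ numComponents (fun e : G.edgeSet => (e : Sym2 V)) s := by
  classical
  have key : ∀ k : ℕ, (chromaticPolynomial G).eval (k : ℤ) =
      (∑ s : Finset G.edgeSet, (-1) ^ s.card *
        (X : ℤ[X]) ^ numComponents (fun e : G.edgeSet => (e : Sym2 V)) s).eval (k : ℤ) := by
    intro k
    have e : G.Coloring (Fin k) ≃
        {f : V → Fin k // ∀ e : G.edgeSet, ¬ ((e : Sym2 V).map f).IsDiag} :=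
      { toFun := fun c => ⟨c, by
          rintro ⟨e, he⟩
          induction e with
          | h v w =>
            rw [Sym2.map_mk, Sym2.mk_isDiag_iff]
            exact c.valid he⟩
        invFun := fun f => SimpleGraph.Coloring.mk f.1 fun {v w} h => by
          have := f.2 ⟨s(v, w), h⟩
          rwa [Sym2.map_mk, Sym2.mk_isDiag_iff] at this
        left_inv := fun c => rfl
        right_inv := fun f => rfl }
    -- Inclusion-exclusion: the indicator of properness is the product over the edges of `1 - [e is
    -- monochromatic]`, expanded over sets of edges.
    have h1 : ∀ f : V → Fin k, (if ∀ e : G.edgeSet, ¬ ((e : Sym2 V).map f).IsDiag then 1 else 0) =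
        ∑ s : Finset G.edgeSet,
          (-1 : ℤ) ^ s.card * if ∀ e ∈ s, ((e : Sym2 V).map f).IsDiag then 1 else 0 := by
      intro f
      have h := Finset.prod_one_add
        (f := fun e : G.edgeSet => if ((e : Sym2 V).map f).IsDiag then (-1 : ℤ) else 0) univ
      rw [Finset.powerset_univ] at h
      refine Eq.trans ?_ (h.trans (Finset.sum_congr rfl fun s _ => ?_))
      · split_ifs with hf
        · exact (Finset.prod_eq_one fun e _ => by rw [if_neg (hf e), add_zero]).symm
        · push Not at hf
          obtain ⟨e, he⟩ := hf
          exact (Finset.prod_eq_zero (Finset.mem_univ e) (by rw [if_pos he, add_neg_cancel])).symm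
      · rw [Finset.prod_ite_zero, Finset.prod_const, mul_ite, mul_one, mul_zero]
        split_ifs <;> rfl
    rw [chromaticPolynomial_eval, Nat.card_congr e, Nat.card_eq_fintype_card, Fintype.card_subtype,
      Finset.card_filter, Polynomial.eval_finsetSum]
    push_cast
    simp only [h1]
    rw [Finset.sum_comm]
    refine Finset.sum_congr rfl fun s _ => ?_
    rw [← Finset.mul_sum, Finset.sum_boole, ← Fintype.card_subtype, ← Nat.card_eq_fintype_card,
      card_constant_on_components]
    simp
  refine Polynomial.eq_of_infinite_eval_eq _ _ (Set.Infinite.mono ?_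
    (Set.infinite_range_of_injective (Nat.cast_injective (R := ℤ))))
  rintro _ ⟨k, rfl⟩
  exact key k

open Polynomial in
theorem reducedChromaticPolynomial_eq_sum [Fintype V] [Nonempty V] (G : SimpleGraph V)
    [Fintype G.edgeSet] :
    reducedChromaticPolynomial G = ∑ s : Finset G.edgeSet,
      (-1) ^ s.card * X ^ (numComponents (fun e : G.edgeSet => (e : Sym2 V)) s - 1) := by
  refine mul_left_cancel₀ (Polynomial.X_ne_zero (R := ℤ)) ?_
  rw [X_mul_reducedChromaticPolynomial, chromaticPolynomial_eq_sum, Finset.mul_sum]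
  refine Finset.sum_congr rfl fun s _ => ?_
  -- There is at least one component, so the truncated exponent `numComponents - 1` is a true
  -- difference and a factor `X` can be cancelled.
  have hpos : 0 < numComponents (fun e : G.edgeSet => (e : Sym2 V)) s :=
    Nat.card_pos_iff.2 ⟨⟨SimpleGraph.connectedComponentMk _ (Classical.arbitrary V)⟩, inferInstance⟩
  obtain ⟨m, hm⟩ := Nat.exists_eq_succ_of_ne_zero hpos.ne'
  rw [hm, Nat.succ_sub_one, pow_succ]
  ring

end Whitney

/-! ### Consequences for a connected simple graph -/

section Invariants

theorem stateGraph_univ {V : Type*} (G : SimpleGraph V) [Fintype G.edgeSet] :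
    stateGraph (fun e : G.edgeSet => (e : Sym2 V)) univ = G := by
  simp [stateGraph]

variable {V : Type*} [Fintype V] (G : SimpleGraph V) [Fintype G.edgeSet] [LinearOrder G.edgeSet]
  (r : V)

theorem subsingleton_reducedCohomology_of_connected (hG : G.Connected) {i j : ℕ}
    (hij : i + j ≠ Fintype.card V - 1) : Subsingleton (reducedCohomology G r i j) :=
  subsingleton_reducedCohomology (by rw [stateGraph_univ]; exact hG.preconnected) hij

theorem reducedCohomologyDim_eq_zero (hG : G.Connected) {i j : ℕ}
    (hij : i + j ≠ Fintype.card V - 1) : reducedCohomologyDim G r i j = 0 :=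
  have := subsingleton_reducedCohomology_of_connected G r hG hij
  Module.finrank_zero_of_subsingleton

open Polynomial in
theorem gradedEulerCharacteristic_eq : gradedEulerCharacteristic G r =
    (reducedChromaticPolynomial G).comp (1 + X) := by
  have : Nonempty V := ⟨r⟩
  have h1 : ∀ d : ℕ → ℕ → ℕ, ∑ i ∈ range (Fintype.card G.edgeSet + 1),
      ∑ j ∈ range (Fintype.card V), (-1) ^ i * (X : ℤ[X]) ^ j * (d i j : ℤ[X]) =
      ∑ j ∈ range (Fintype.card V), X ^ j *
        C (∑ i ∈ range (Fintype.card G.edgeSet + 1), (-1) ^ i * (d i j : ℤ)) := by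
    intro d
    rw [Finset.sum_comm]
    refine Finset.sum_congr rfl fun j _ => ?_
    rw [map_sum, Finset.mul_sum]
    refine Finset.sum_congr rfl fun i _ => ?_
    simp only [map_mul, map_pow, map_neg, map_one, map_natCast]
    ring
  unfold gradedEulerCharacteristic reducedCohomologyDim
  rw [h1]
  simp only [sum_finrank_reducedCohomology_eq]
  rw [← h1, sum_finrank_cochainGroup, reducedChromaticPolynomial_eq_sum,
    Polynomial.sum_comp]
  exact Finset.sum_congr rfl fun s _ => by simp

/-- The guard is needed because for `i` beyond the diagonal the truncated index `n - 1 - i` would be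
`0`, although no degree is left. -/
theorem sum_diagonal {A : Type*} [CommRing A] (hG : G.Connected) (a : ℕ → ℕ → A) (i : ℕ) :
    ∑ j ∈ range (Fintype.card V), a i j * (reducedCohomologyDim G r i j : A) =
      if i < Fintype.card V then a i (Fintype.card V - 1 - i) *
        (reducedCohomologyDim G r i (Fintype.card V - 1 - i) : A) else 0 := by
  split_ifs with h
  · refine Finset.sum_eq_single_of_mem _ (Finset.mem_range.2 (by omega)) fun j _ hj => ?_
    rw [reducedCohomologyDim_eq_zero G r hG (by omega), Nat.cast_zero, mul_zero]
  · refine Finset.sum_eq_zero fun j hj => ?_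
    have hn : 0 < Fintype.card V := Fintype.card_pos_iff.2 ⟨r⟩
    rw [reducedCohomologyDim_eq_zero G r hG (by omega), Nat.cast_zero, mul_zero]

theorem bettiNumber_eq (hG : G.Connected) {i j : ℕ} (hij : i + j = Fintype.card V - 1) :
    bettiNumber G r i = reducedCohomologyDim G r i j := by
  have hn : 0 < Fintype.card V := Fintype.card_pos_iff.2 ⟨r⟩
  refine Finset.sum_eq_single_of_mem _ (Finset.mem_range.2 (by omega)) fun k _ hk => ?_
  exact reducedCohomologyDim_eq_zero G r hG (by omega)

/-- Sums over all bidegrees reduce to sums over the diagonal. -/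
theorem sum_bidegree_eq {A : Type*} [CommRing A] (hG : G.Connected) (a : ℕ → ℕ → A) :
    ∑ i ∈ range (Fintype.card G.edgeSet + 1), ∑ j ∈ range (Fintype.card V),
        a i j * (reducedCohomologyDim G r i j : A) =
      ∑ i ∈ range (Fintype.card V), a i (Fintype.card V - 1 - i) * (bettiNumber G r i : A) := by
  have h2 : ∑ i ∈ range (Fintype.card V), a i (Fintype.card V - 1 - i) * (bettiNumber G r i : A) =
      ∑ i ∈ range (Fintype.card V), ∑ j ∈ range (Fintype.card V),
        a i j * (reducedCohomologyDim G r i j : A) := by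
    refine Finset.sum_congr rfl fun i hi => ?_
    rw [Finset.mem_range] at hi
    rw [sum_diagonal G r hG, if_pos hi, bettiNumber_eq G r hG (j := Fintype.card V - 1 - i)
      (by omega)]
  rw [h2]
  -- The two ranges of `i` differ only by indices that contribute nothing: above the number of edges
  -- there are no states, and from `n` on there is no diagonal degree.
  rcases le_total (Fintype.card G.edgeSet + 1) (Fintype.card V) with h | h
  · refine Finset.sum_subset (Finset.range_mono h) fun i _ hi => Finset.sum_eq_zero fun j _ => ?_
    have h0 : reducedCohomologyDim G r i j = 0 :=
      finrank_reducedCohomology_eq_zero (by rw [Finset.mem_range] at hi; omega) j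
    rw [h0, Nat.cast_zero, mul_zero]
  · refine (Finset.sum_subset (Finset.range_mono h) fun i _ hi => ?_).symm
    rw [sum_diagonal G r hG, if_neg fun h => hi (Finset.mem_range.2 h)]

open Polynomial in
theorem reducedChromaticPolynomial_comp (hG : G.Connected) :
    (reducedChromaticPolynomial G).comp (1 + X) =
      ∑ i ∈ range (Fintype.card V), (-1) ^ i * X ^ (Fintype.card V - 1 - i) *
        (bettiNumber G r i : ℤ[X]) := by
  rw [← gradedEulerCharacteristic_eq G r]
  exact sum_bidegree_eq G r hG fun i j => (-1) ^ i * (X : ℤ[X]) ^ j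

open Polynomial in
theorem chromaticPolynomial_eq_iff (hG : G.Connected) (h : ℕ → ℤ) :
    chromaticPolynomial G = ∑ i ∈ range (Fintype.card V),
        (-1) ^ i * C (h i) * (X * (X - 1) ^ (Fintype.card V - 1 - i)) ↔
      ∀ i < Fintype.card V, h i = bettiNumber G r i := by
  have : Nonempty V := ⟨r⟩
  -- After cancelling `X`, the substitution `X ↦ 1 + X` is invertible and turns powers of `X - 1`
  -- into monomials, so coefficients can be compared.
  have hinj : Function.Injective fun p : ℤ[X] => p.comp (1 + X) := by
    refine Function.LeftInverse.injective (g := fun p => p.comp (X - 1)) fun p => ?_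
    simp [Polynomial.comp_assoc]
  have h1 : ∑ i ∈ range (Fintype.card V),
        (-1) ^ i * C (h i) * ((X : ℤ[X]) * (X - 1) ^ (Fintype.card V - 1 - i)) =
      X * ∑ i ∈ range (Fintype.card V),
        (-1) ^ i * C (h i) * (X - 1) ^ (Fintype.card V - 1 - i) := by
    rw [Finset.mul_sum]
    exact Finset.sum_congr rfl fun i _ => by ring
  have h2 : (∑ i ∈ range (Fintype.card V),
        (-1) ^ i * C (h i) * ((X : ℤ[X]) - 1) ^ (Fintype.card V - 1 - i)).comp (1 + X) =
      ∑ i ∈ range (Fintype.card V), (-1) ^ i * X ^ (Fintype.card V - 1 - i) * C (h i) := by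
    rw [Polynomial.sum_comp]
    refine Finset.sum_congr rfl fun i _ => ?_
    simp only [mul_comp, pow_comp, sub_comp, neg_comp, one_comp, C_comp, X_comp,
      add_sub_cancel_left]
    ring
  rw [h1, ← X_mul_reducedChromaticPolynomial, (mul_right_injective₀ X_ne_zero).eq_iff,
    ← hinj.eq_iff]
  simp only [h2, reducedChromaticPolynomial_comp G r hG]
  have hcoeff : ∀ (g : ℕ → ℤ) (k : ℕ), k < Fintype.card V →
      (∑ i ∈ range (Fintype.card V),
        (-1) ^ i * (X : ℤ[X]) ^ (Fintype.card V - 1 - i) * C (g i)).coeff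
          (Fintype.card V - 1 - k) = (-1) ^ k * g k := by
    intro g k hk
    rw [Polynomial.finsetSum_coeff, Finset.sum_eq_single_of_mem k (Finset.mem_range.2 hk)]
    · rw [show (-1 : ℤ[X]) ^ k * X ^ (Fintype.card V - 1 - k) * C (g k) =
        C ((-1) ^ k * g k) * X ^ (Fintype.card V - 1 - k) by
          simp only [map_mul, map_pow, map_neg, map_one]; ring, coeff_C_mul_X_pow, if_pos rfl]
    · intro i hi hik
      rw [Finset.mem_range] at hi
      rw [show (-1 : ℤ[X]) ^ i * X ^ (Fintype.card V - 1 - i) * C (g i) =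
        C ((-1) ^ i * g i) * X ^ (Fintype.card V - 1 - i) by
          simp only [map_mul, map_pow, map_neg, map_one]; ring, coeff_C_mul_X_pow,
        if_neg (by omega)]
  constructor
  · intro heq k hk
    have h3 := hcoeff h k hk
    have h4 := hcoeff (fun i => bettiNumber G r i) k hk
    simp only [map_natCast] at h4
    rw [← heq, h4] at h3
    exact (mul_left_cancel₀ (pow_ne_zero k (by norm_num)) h3).symm
  · intro hh
    refine Finset.sum_congr rfl fun i hi => ?_
    rw [hh i (Finset.mem_range.1 hi), map_natCast]

open Polynomial in
theorem aeval_reducedPoincarePolynomial (hG : G.Connected) {t : ℝ} (q : ℝ) (ht : t ≠ 0) :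
    MvPolynomial.aeval ![t, q] (reducedPoincarePolynomial G r) =
      (-t) ^ (Fintype.card V - 1) * aeval ((t - q) / t) (reducedChromaticPolynomial G) := by
  have h1 : MvPolynomial.aeval ![t, q] (reducedPoincarePolynomial G r) =
      ∑ i ∈ range (Fintype.card V), t ^ i * q ^ (Fintype.card V - 1 - i) *
        (bettiNumber G r i : ℝ) := by
    rw [← sum_bidegree_eq G r hG fun i j => t ^ i * q ^ j]
    simp [reducedPoincarePolynomial]
  have h2 : aeval ((t - q) / t) (reducedChromaticPolynomial G) =
      aeval (-q / t) ((reducedChromaticPolynomial G).comp (1 + X)) := by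
    rw [Polynomial.aeval_comp]
    congr 2
    simp only [map_add, map_one, aeval_X]
    field_simp
    ring
  rw [h1, h2, reducedChromaticPolynomial_comp G r hG, map_sum, Finset.mul_sum]
  refine Finset.sum_congr rfl fun i hi => ?_
  rw [Finset.mem_range] at hi
  simp only [map_mul, map_pow, map_neg, map_one, aeval_X, map_natCast]
  -- With `n - 1 = i + k`, the signs of `(-t)^(i+k)` cancel against `(-1)^i` from the Euler
  -- characteristic and `(-1)^k` from `(-q/t)^k`.
  obtain ⟨k, hk⟩ : ∃ k, Fintype.card V - 1 = i + k := ⟨_, (Nat.add_sub_cancel' (by omega)).symm⟩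
  rw [hk, Nat.add_sub_cancel_left, pow_add, div_pow, neg_pow t i, neg_pow t k, neg_pow q k]
  have hs : ∀ m : ℕ, (-1 : ℝ) ^ m * (-1) ^ m = 1 := fun m => by
    rw [← mul_pow]
    norm_num
  have htk : t ^ k ≠ 0 := pow_ne_zero k ht
  field_simp
  linear_combination (-(q ^ k * (bettiNumber G r i : ℝ))) *
    (hs i * ((-1) ^ k * (-1) ^ k) + hs k)

end Invariants

end ChromaticCohomology

open Polynomial in
/-- `G` is a finite simple connected graph with base point `r` and ordered edges. -/
theorem mainTheorem3 {V : Type*} [Fintype V] (G : SimpleGraph V) [Fintype G.edgeSet]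
    [LinearOrder G.edgeSet] (hG : G.Connected) (r : V) :
    -- the graded Euler characteristic is the reduced chromatic polynomial at `1 + q`
    ChromaticCohomology.gradedEulerCharacteristic G r =
        (ChromaticCohomology.reducedChromaticPolynomial G).comp (1 + X) ∧
    -- the cohomology is concentrated on the diagonal `i + j = n - 1`
    (∀ i j : ℕ, i + j ≠ Fintype.card V - 1 →
        Subsingleton (ChromaticCohomology.reducedCohomology G r i j)) ∧
    -- so that the `i`-th Betti number is the dimension of `H^{i,n-1-i}`
    (∀ i j : ℕ, i + j = Fintype.card V - 1 →
        ChromaticCohomology.bettiNumber G r i = ChromaticCohomology.reducedCohomologyDim G r i j) ∧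
    -- the Betti numbers are the coefficients of the chromatic polynomial, up to sign
    (∀ h : ℕ → ℤ,
        ChromaticCohomology.chromaticPolynomial G =
            ∑ i ∈ Finset.range (Fintype.card V),
              (-1) ^ i * C (h i) * (X * (X - 1) ^ (Fintype.card V - 1 - i)) ↔
          ∀ i < Fintype.card V, h i = ChromaticCohomology.bettiNumber G r i) ∧
    -- the Poincaré polynomial
    (∀ t q : ℝ, t ≠ 0 →
        MvPolynomial.aeval ![t, q] (ChromaticCohomology.reducedPoincarePolynomial G r) =
          (-t) ^ (Fintype.card V - 1) *
            aeval ((t - q) / t) (ChromaticCohomology.reducedChromaticPolynomial G)) := by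
  exact ⟨ChromaticCohomology.gradedEulerCharacteristic_eq G r,
    fun _ _ h => ChromaticCohomology.subsingleton_reducedCohomology_of_connected G r hG h,
    fun _ _ h => ChromaticCohomology.bettiNumber_eq G r hG h,
    ChromaticCohomology.chromaticPolynomial_eq_iff G r hG,
    fun _ q ht => ChromaticCohomology.aeval_reducedPoincarePolynomial G r hG q ht⟩
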